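/- Let $\alpha$ be an infinite set (for instance an infinite ordinal). An $\alpha$-dimensional cylindric algebra is an algebra $\langle A,+,-,c_i,d_{ij}\rangle_{i,j\in\alpha}$ such that $\langle A,+,-\rangle$ is a Boolean algebra and, for all distinct $i,j,k\in\alpha$ and all $x,y\in A$, $$c_ic_jx=c_jc_ix,\quad x\le c_ix=c_ic_ix,\quad c_i(x+y)=c_ix+c_iy,\quad c_i(-c_ix)=-c_ix,$$ $$d_{ii}=1,\quad d_{ij}=d_{ji},\quad c_j(d_{ij}\cdot d_{jk})=d_{ik},\quad c_id_{ij}=1,\quad d_{ij}\cdot c_i(d_{ij}\cdot x)=d_{ij}\cdot x .$$ Let $\mathsf{Lf}_\alpha$ be the class of locally finite dimensional ones, i.e. those in which for every $x\in A$ the set $\{i\in\alpha : c_ix\neq x\}$ is finite. Let $\mathsf{RCA}_\alpha$ be the class of representable ones, i.e. the algebras isomorphic to a subalgebra of $\langle \mathcal P(V),\cup,-,C_i^V,D_{ij}^V\rangle_{i,j\in\alpha}$, where $V$ is a disjoint union of sets of the form ${}^\alpha U$ (all functions from $\alpha$ to $U$), $-$ is complementation relative to $V$, $C_i^VX$ is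 the set of all $t\in V$ that agree with some $s\in X$ at every index other than $i$, and $D_{ij}^V=\{s\in V: s_i=s_j\}$. A first-order sentence is $\Delta_2$ if it is logically equivalent both to a $\Sigma_2$ sentence ($\exists\bar x\forall\bar y\,\psi$ with $\psi$ quantifier-free) and to a $\Pi_2$ sentence ($\forall\bar x\exists\bar y\,\psi$ with $\psi$ quantifier-free). An inductivity axiom is a sentence $$\forall x_1\dots x_n\; e(c_ix_1,\dots,c_ix_n)\ \to\ \forall x_1\dots x_n\; e(x_1,\dots,x_n),$$ where $e$ is an equation between terms in the language of $\alpha$-dimensional cylindric algebras and $i\in\alpha$ is an index not occurring in $e$. Then there is a $\Delta_2$ first-order sentence $\varphi$ in the language of $\alpha$-dimensional cylindric algebras which is valid in every member of $\mathsf{Lf}_\alpha$ but fails in some member of $\mathsf{RCA}_\alpha$. Moreover, $\varphi$ can be chosen to be an inductivity axiom. -/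

import Mathlib

open FirstOrder FirstOrder.Language

universe u v w

namespace CylAlg

/-! ### The similarity type of cylindric algebras -/

/-- Operation symbols of `⟨A, +, -, c_i, d_{ij}⟩` for `i, j ∈ α`, graded by arity. -/
inductive OpSymb (α : Type u) : ℕ → Type u
  | add : OpSymb α 2
  | neg : OpSymb α 1
  | cyl (i : α) : OpSymb α 1
  | diag (i j : α) : OpSymb α 0

/-- The first-order language of `α`-dimensional cylindric algebras (no relation symbols besides
equality). An algebra of this similarity type is a type `A` with `[(lang α).Structure A]`. -/
def lang (α : Type u) : FirstOrder.Language.{u, 0} where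
  Functions := OpSymb α
  Relations := fun _ => Empty

section Operations

variable (α : Type u) {A : Type v} [(lang α).Structure A]

/-- The operation `x + y` of an algebra. -/
def add (x y : A) : A := Structure.funMap (L := lang α) (OpSymb.add (α := α)) ![x, y]

/-- The operation `-x` of an algebra. -/
def neg (x : A) : A := Structure.funMap (L := lang α) (OpSymb.neg (α := α)) ![x]

variable {α}

/-- The cylindrification `c_i x` of an algebra. -/
def cyl (i : α) (x : A) : A := Structure.funMap (L := lang α) (OpSymb.cyl i) ![x]

variable (A)

/-- The diagonal constant `d_{ij}` of an algebra. -/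
def diag (i j : α) : A := Structure.funMap (L := lang α) (OpSymb.diag i j) ![]

end Operations

/-! ### Cylindric algebras and locally finite dimensional cylindric algebras -/

/-- The algebra `A` has `+` and `-` as join and complement of the given Boolean algebra, and its
cylindrifications and diagonals satisfy the cylindric axioms. -/
structure CylindricLaws (α : Type u) (A : Type v) [(lang α).Structure A] [BooleanAlgebra A] :
    Prop where
  add_eq : ∀ x y : A, add α x y = x ⊔ y
  neg_eq : ∀ x : A, neg α x = xᶜ
  cyl_comm : ∀ (i j : α) (x : A), cyl i (cyl j x) = cyl j (cyl i x)
  le_cyl : ∀ (i : α) (x : A), x ≤ cyl i x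
  cyl_cyl : ∀ (i : α) (x : A), cyl i (cyl i x) = cyl i x
  cyl_sup : ∀ (i : α) (x y : A), cyl i (x ⊔ y) = cyl i x ⊔ cyl i y
  cyl_compl_cyl : ∀ (i : α) (x : A), cyl i (cyl i x)ᶜ = (cyl i x)ᶜ
  diag_self : ∀ i : α, diag A i i = ⊤
  diag_comm : ∀ i j : α, diag A i j = diag A j i
  cyl_diag_inf_diag : ∀ i j k : α, i ≠ j → j ≠ k → i ≠ k →
    cyl j (diag A i j ⊓ diag A j k) = diag A i k
  cyl_diag : ∀ i j : α, i ≠ j → cyl i (diag A i j) = ⊤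
  diag_inf_cyl : ∀ (i j : α) (x : A), i ≠ j →
    diag A i j ⊓ cyl i (diag A i j ⊓ x) = diag A i j ⊓ x

/-- `A ∈ CA_α`. -/
def IsCylindricAlgebra (α : Type u) (A : Type v) [(lang α).Structure A] : Prop :=
  ∃ _ : BooleanAlgebra A, CylindricLaws α A

/-- `A ∈ Lf_α`: a cylindric algebra each of whose elements is a fixed point of all but finitely
many cylindrifications. -/
def IsLocallyFiniteDimensional (α : Type u) (A : Type v) [(lang α).Structure A] : Prop :=
  IsCylindricAlgebra α A ∧ ∀ x : A, {i : α | cyl i x ≠ x}.Finite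

/-! ### Representable cylindric algebras -/

/-- The carrier of the full cylindric set algebra with unit `V ⊆ ^αU`: the powerset of `V`. -/
abbrev FullSetAlgebra {α : Type u} {U : Type v} (V : Set (α → U)) : Type (max u v) := Set V

/-- The operations of the full cylindric set algebra with unit `V`: union, complement in `V`,
`C_i X = {s(i/u) ∈ V : s ∈ X, u ∈ U}` (the points of `V` that agree off `i` with a point of `X`),
and `D_{ij} = {s ∈ V : s_i = s_j}`. -/
instance FullSetAlgebra.structure {α : Type u} {U : Type v} (V : Set (α → U)) :
    (lang α).Structure (FullSetAlgebra V) where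
  funMap {n} (f : OpSymb α n) (x : Fin n → Set V) :=
    match n, f, x with
    | _, .add, x => (x 0 ∪ x 1 : Set V)
    | _, .neg, x => ((x 0)ᶜ : Set V)
    | _, .cyl i, x => {t : V | ∃ s ∈ x 0, ∀ j, j ≠ i → t.1 j = s.1 j}
    | _, .diag i j, _ => {s : V | s.1 i = s.1 j}
  RelMap r := nomatch r

/-- The `α`-dimensional space `^αX` over a subset `X` of `U`. -/
def cartesianSpace (α : Type u) {U : Type v} (X : Set U) : Set (α → U) :=
  {s | ∀ i, s i ∈ X}

/-- `V` is a disjoint union of `α`-dimensional spaces. -/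
def IsDisjointUnionOfSpaces {α : Type u} {U : Type v} (V : Set (α → U)) : Prop :=
  ∃ B : Set (Set U), B.PairwiseDisjoint (cartesianSpace α) ∧ V = ⋃ X ∈ B, cartesianSpace α X

/-- `A ∈ RCA_α`: `A` is isomorphic to a subalgebra of (that is, embeds into) a full cylindric set
algebra whose unit is a disjoint union of `α`-dimensional spaces. -/
def IsRepresentable (α : Type u) (A : Type v) [(lang α).Structure A] : Prop :=
  ∃ (U : Type (max u v)) (V : Set (α → U)), IsDisjointUnionOfSpaces V ∧
    Nonempty (A ↪[lang α] FullSetAlgebra V)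

/-! ### `Δ₂` formulas -/

/-- `∃x̄ ∀ȳ ψ` with `ψ` quantifier-free. -/
inductive IsSigmaTwo {L : FirstOrder.Language.{u, v}} {β : Type w} : ∀ {n : ℕ}, L.BoundedFormula β n → Prop
  | of_isUniversal {n : ℕ} {φ : L.BoundedFormula β n} (h : φ.IsUniversal) : IsSigmaTwo φ
  | ex {n : ℕ} {φ : L.BoundedFormula β (n + 1)} (h : IsSigmaTwo φ) : IsSigmaTwo φ.ex

/-- `∀x̄ ∃ȳ ψ` with `ψ` quantifier-free. -/
inductive IsPiTwo {L : FirstOrder.Language.{u, v}} {β : Type w} : ∀ {n : ℕ}, L.BoundedFormula β n → Prop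
  | of_isExistential {n : ℕ} {φ : L.BoundedFormula β n} (h : φ.IsExistential) : IsPiTwo φ
  | all {n : ℕ} {φ : L.BoundedFormula β (n + 1)} (h : IsPiTwo φ) : IsPiTwo φ.all

/-- `φ` is logically equivalent both to a `Σ₂` sentence and to a `Π₂` sentence. -/
def IsDeltaTwo {L : FirstOrder.Language.{u, v}} (φ : L.Sentence) : Prop :=
  (∃ σ : L.Sentence, IsSigmaTwo σ ∧ φ ⇔[∅] σ) ∧ (∃ π : L.Sentence, IsPiTwo π ∧ φ ⇔[∅] π)

/-! ### Inductivity axioms -/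

/-- The indices of an operation symbol. -/
def OpSymb.ind {α : Type u} : ∀ {n : ℕ}, OpSymb α n → Set α
  | _, .add => ∅
  | _, .neg => ∅
  | _, .cyl i => {i}
  | _, .diag i j => {i, j}

/-- The set of indices occurring in a term. -/
def ind {α : Type u} {β : Type w} : (lang α).Term β → Set α
  | .var _ => ∅
  | .func f ts => OpSymb.ind f ∪ ⋃ k, ind (ts k)

/-- The term `c_i τ`. -/
def cylTerm {α : Type u} {β : Type w} (i : α) (τ : (lang α).Term β) : (lang α).Term β :=
  Functions.apply₁ (L := lang α) (OpSymb.cyl i) τ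

/-- The term `τ(c_i x₁, …, c_i xₙ)`. -/
def substCyl {α : Type u} {β : Type w} (i : α) (τ : (lang α).Term β) : (lang α).Term β :=
  τ.subst fun x => cylTerm i (Term.var x)

/-- `φ` is `∀x̄ e(c_i x₁, …, c_i xₙ) → ∀x̄ e(x₁, …, xₙ)` for some equation `e` in the variables
`x₁, …, xₙ` and some index `i` that does not occur in `e`. -/
def IsInductivityAxiom {α : Type u} (φ : (lang α).Sentence) : Prop :=
  ∃ (n : ℕ) (τ σ : (lang α).Term (Empty ⊕ Fin n)) (i : α), i ∉ ind τ ∪ ind σ ∧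
    φ = ((substCyl i τ).bdEqual (substCyl i σ)).alls.imp (τ.bdEqual σ).alls

end CylAlg

namespace CylAlg

/-! The axiom comes from an equation e(x) in one variable: no section of x in directions a, b, c is
a serial strict order in a, b that is independent of c. With one variable, ∀x P → ∀y Q has the
prenex forms ∃x∀y and ∀y∃x, hence is Δ₂ (`isDeltaTwo_alls_imp_alls`). In a locally finite algebra
every inductivity axiom holds: an index j fresh for x and e can play against i, because x ↦ c_j(d_ij
· x) commutes with all terms avoiding i and j (`cyl_diag_inf_realize`).

For the failure, take the base α × ℕ and a generic function h giving natural numbers, the heights,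
to sequences restricted to the indices other than b and c. It vanishes unless the restriction is
injective and finitely different from p ↦ (p, 0), and a suitable new entry realizes any finite
consistent prescription of heights (`exists_isGeneric`). Comparing the height of s with that of s
after s_a is replaced by s_b gives, around the base point, a serial strict order. The algebra
consists of the sets invariant under finitary equivalences `Sim`, which preserve equalities and the
heights of all substitutes on a finite F; back-and-forth (`Sim.exists_update`) closes it under
cylindrification.

An invariant set that also ignores a fourth index i contains no such order R. Indeed R x y is
decided by a sequence with x at a, c, i and y at b. If E is the rest of F, then h sees |E| + 2
indices of F, while only |E| + 2 values are available there: x, y and those on E. So a nonzero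
height needs both x and y; without i, one of them would do. Hence comparable x, y outside s(E) can
be interchanged (`sim_pair_swap`) or completed by a generic z to a triangle of equivalent pairs
(`exists_sim_pair_triangle`). Either way R has a cycle. -/

theorem realize_boundedFormula_alls {L : FirstOrder.Language.{u, v}} {M : Type w} [L.Structure M]
    {n : ℕ} (φ : L.BoundedFormula Empty n) (v : Empty → M) (xs : Fin 0 → M) :
    BoundedFormula.Realize φ.alls v xs ↔ ∀ ys, φ.Realize v ys := by
  rw [← BoundedFormula.realize_alls, Formula.Realize, Subsingleton.elim xs default]

/-! ### Validity of inductivity axioms in locally finite dimensional algebras -/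

section Laws

variable {α : Type u} {A : Type v} [(lang α).Structure A]

theorem funMap_add (ts : Fin 2 → A) :
    Structure.funMap (L := lang α) (OpSymb.add (α := α)) ts = add α (ts 0) (ts 1) := by
  unfold add
  congr 1
  funext k
  fin_cases k <;> rfl

theorem funMap_neg (ts : Fin 1 → A) :
    Structure.funMap (L := lang α) (OpSymb.neg (α := α)) ts = neg α (ts 0) := by
  unfold neg
  congr 1
  funext k
  fin_cases k
  rfl

theorem funMap_cyl (i : α) (ts : Fin 1 → A) :
    Structure.funMap (L := lang α) (OpSymb.cyl i) ts = cyl i (ts 0) := by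
  unfold cyl
  congr 1
  funext k
  fin_cases k
  rfl

theorem funMap_diag (i j : α) (ts : Fin 0 → A) :
    Structure.funMap (L := lang α) (OpSymb.diag i j) ts = diag A i j := by
  unfold diag
  congr 1
  funext k
  exact k.elim0

theorem realize_cylTerm {β : Type w} (i : α) (τ : (lang α).Term β) (v : β → A) :
    (cylTerm i τ).realize v = cyl i (τ.realize v) := by
  unfold cylTerm cyl
  exact Term.realize_functions_apply₁

theorem realize_substCyl {β : Type w} (i : α) (τ : (lang α).Term β) (v : β → A) :
    (substCyl i τ).realize v = τ.realize fun x => cyl i (v x) := by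
  unfold substCyl
  rw [Term.realize_subst]
  congr 1
  funext x
  rw [realize_cylTerm, Term.realize_var]

namespace CylindricLaws

variable [BooleanAlgebra A] (h : CylindricLaws α A)

include h

theorem cyl_mono (i : α) {x y : A} (hxy : x ≤ y) : cyl i x ≤ cyl i y := by
  rw [← sup_eq_right.2 hxy, h.cyl_sup]
  exact le_sup_left

theorem cyl_bot (i : α) : cyl i (⊥ : A) = ⊥ := by
  have h1 : cyl i (⊤ : A) = ⊤ := top_le_iff.1 (h.le_cyl i ⊤)
  have := h.cyl_compl_cyl i ⊤
  rwa [h1, compl_top] at this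

/-- Split x along c_i y: the part below the complement of c_i y stays there under c_i, since that
complement is c_i-closed. -/
theorem cyl_inf_cyl (i : α) (x y : A) : cyl i (x ⊓ cyl i y) = cyl i x ⊓ cyl i y := by
  apply le_antisymm
  · refine le_inf (h.cyl_mono i inf_le_left) ?_
    calc cyl i (x ⊓ cyl i y) ≤ cyl i (cyl i y) := h.cyl_mono i inf_le_right
      _ = cyl i y := h.cyl_cyl i y
  · have h1 : cyl i x = cyl i (x ⊓ cyl i y) ⊔ cyl i (x ⊓ (cyl i y)ᶜ) := by
      rw [← h.cyl_sup, ← inf_sup_left, sup_compl_eq_top, inf_top_eq]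
    have h2 : cyl i (x ⊓ (cyl i y)ᶜ) ≤ (cyl i y)ᶜ := by
      conv_rhs => rw [← h.cyl_compl_cyl]
      exact h.cyl_mono i inf_le_right
    rw [h1, inf_sup_right]
    refine sup_le inf_le_left ?_
    calc cyl i (x ⊓ (cyl i y)ᶜ) ⊓ cyl i y ≤ (cyl i y)ᶜ ⊓ cyl i y := inf_le_inf_right _ h2
      _ = ⊥ := by rw [inf_comm, inf_compl_eq_bot]
      _ ≤ _ := bot_le

theorem cyl_diag_of_ne {i j k : α} (hki : k ≠ i) (hkj : k ≠ j) :
    cyl k (diag A i j) = diag A i j := by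
  by_cases hij : i = j
  · subst hij
    rw [h.diag_self]
    exact top_le_iff.1 (h.le_cyl k ⊤)
  · rw [← h.cyl_diag_inf_diag i k j hki.symm hkj hij, h.cyl_cyl]

/-- Cylindric substitution of the index `i` for the index `j` preserves every term in which
neither index occurs. -/
theorem cyl_diag_inf_realize {β : Type w} {i j : α} (hij : i ≠ j) (v : β → A)
    (τ : (lang α).Term β) (hi : i ∉ ind τ) (hj : j ∉ ind τ) :
    cyl j (diag A i j ⊓ τ.realize v) = τ.realize fun x => cyl j (diag A i j ⊓ v x) := by
  induction τ with
  | var x => rfl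
  | @func n f ts ih =>
    have hi' : i ∉ OpSymb.ind f ∧ ∀ k, i ∉ ind (ts k) := by
      simpa [ind] using hi
    have hj' : j ∉ OpSymb.ind f ∧ ∀ k, j ∉ ind (ts k) := by
      simpa [ind] using hj
    have ih' := fun k => ih k (hi'.2 k) (hj'.2 k)
    cases f with
    | add =>
      simp only [Term.realize, funMap_add, h.add_eq, inf_sup_left, h.cyl_sup, ih']
    | neg =>
      simp only [Term.realize, funMap_neg, h.neg_eq, ← ih']
      generalize (ts 0).realize v = x
      symm
      -- Disjointness comes from d_ij · c_j(d_ij · y) = d_ij · y, covering from c_j d_ij = 1.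
      apply IsCompl.compl_eq
      apply IsCompl.of_eq
      · have e1 : diag A i j ⊓ cyl j (diag A i j ⊓ xᶜ) = diag A i j ⊓ xᶜ := by
          have := h.diag_inf_cyl j i xᶜ hij.symm
          rwa [h.diag_comm j i] at this
        rw [← h.cyl_inf_cyl, inf_right_comm, e1, inf_assoc, inf_comm xᶜ x, inf_compl_eq_bot,
          inf_bot_eq, h.cyl_bot]
      · rw [← h.cyl_sup, ← inf_sup_left, sup_compl_eq_top, inf_top_eq, h.diag_comm,
          h.cyl_diag j i hij.symm]
    | cyl k =>
      have hik : k ≠ i := fun e => hi'.1 (by simp [OpSymb.ind, e])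
      have hjk : k ≠ j := fun e => hj'.1 (by simp [OpSymb.ind, e])
      simp only [Term.realize, funMap_cyl, ← ih']
      -- c_k passes through the meet because d_ij is c_k-closed.
      rw [h.cyl_comm k j, inf_comm _ ((ts 0).realize v), ← h.cyl_diag_of_ne hik hjk,
        h.cyl_inf_cyl, inf_comm]
    | diag k l =>
      have hik : i ≠ k ∧ i ≠ l := by simpa [OpSymb.ind] using hi'.1
      have hjk : j ≠ k ∧ j ≠ l := by simpa [OpSymb.ind] using hj'.1
      simp only [Term.realize, funMap_diag]
      rw [← h.cyl_diag_of_ne hjk.1 hjk.2, h.cyl_inf_cyl, h.diag_comm,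
        h.cyl_diag j i hij.symm, top_inf_eq]

end CylindricLaws

theorem finite_ind {β : Type w} (τ : (lang α).Term β) : (ind τ).Finite := by
  induction τ with
  | var x => exact Set.finite_empty
  | @func n f ts ih =>
    refine Set.Finite.union ?_ (Set.finite_iUnion ih)
    cases f <;> simp [OpSymb.ind]

/-- Choose j outside e, different from i, with every x fixed by c_j, and use the premise at d_ij ·
x. Applying c_j(d_ij · –) to it turns each argument c_i(d_ij · x) into c_j(d_ij · x) = x. -/
theorem IsLocallyFiniteDimensional.realize_of_isInductivityAxiom [Infinite α]
    (hA : IsLocallyFiniteDimensional α A) {φ : (lang α).Sentence} (hφ : IsInductivityAxiom φ) :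
    A ⊨ φ := by
  obtain ⟨n, τ, σ, i, hi, rfl⟩ := hφ
  obtain ⟨⟨B, h⟩, hfin⟩ := hA
  have hi' : i ∉ ind τ ∧ i ∉ ind σ := by simpa using hi
  change Formula.Realize _ _
  unfold Formula.Realize
  rw [BoundedFormula.realize_imp, realize_boundedFormula_alls, realize_boundedFormula_alls]
  intro hyp xs
  have hF : (ind τ ∪ ind σ ∪ {i} ∪ ⋃ k, {j | cyl j (xs k) ≠ xs k}).Finite :=
    (((finite_ind τ).union (finite_ind σ)).union (Set.finite_singleton i)).union
      (Set.finite_iUnion fun k => hfin (xs k))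
  obtain ⟨j, hj⟩ := hF.infinite_compl.nonempty
  simp only [Set.mem_compl_iff, Set.mem_union, Set.mem_singleton_iff, Set.mem_iUnion,
    Set.mem_ofPred_eq, not_or, not_exists, not_not] at hj
  obtain ⟨⟨⟨hjτ, hjσ⟩, hji⟩, hjx⟩ := hj
  have hij : i ≠ j := Ne.symm hji
  have key := hyp fun k => diag A i j ⊓ xs k
  rw [BoundedFormula.realize_bdEqual, realize_substCyl, realize_substCyl] at key
  rw [BoundedFormula.realize_bdEqual]
  have key' := congrArg (fun z => cyl j (diag A i j ⊓ z)) key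
  rw [h.cyl_diag_inf_realize hij _ τ hi'.1 hjτ, h.cyl_diag_inf_realize hij _ σ hi'.2 hjσ] at key'
  convert key' using 2 <;>
  · funext x
    rcases x with x | x
    · exact x.elim
    · simp only [Sum.elim_inr]
      rw [h.diag_inf_cyl i j _ hij]
      conv_rhs => rw [← hjx x, h.cyl_inf_cyl, h.diag_comm, h.cyl_diag j i hij.symm, top_inf_eq]
      exact (hjx x).symm

end Laws

/-! ### Quantifier complexity of inductivity axioms in one variable -/

/-- The quantifiers of premise and conclusion bind independent variables, so they can be pulled out
in either order. Models are nonempty, which supplies the existential witness when the premise holds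
everywhere. -/
theorem isDeltaTwo_alls_imp_alls {L : FirstOrder.Language.{u, v}}
    (τ₁ σ₁ τ₂ σ₂ : L.Term (Empty ⊕ Fin 1)) :
    IsDeltaTwo ((τ₁.bdEqual σ₁).alls.imp (τ₂.bdEqual σ₂).alls : L.Sentence) := by
  let ren (k : Fin 2) (t : L.Term (Empty ⊕ Fin 1)) : L.Term (Empty ⊕ Fin 2) :=
    t.relabel (Sum.map id fun _ => k)
  let mat (k l : Fin 2) : L.BoundedFormula Empty 2 :=
    ((ren k τ₁).bdEqual (ren k σ₁)).imp ((ren l τ₂).bdEqual (ren l σ₂))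
  have hqf (k l : Fin 2) : (mat k l).IsQF :=
    (BoundedFormula.IsAtomic.equal _ _).isQF.imp (BoundedFormula.IsAtomic.equal _ _).isQF
  have hren (k : Fin 2) (t : L.Term (Empty ⊕ Fin 1)) {M : Type (max u v)} [L.Structure M]
      (v : Empty → M) (xs : Fin 2 → M) :
      (ren k t).realize (Sum.elim v xs) = t.realize (Sum.elim v fun _ => xs k) := by
    simp only [ren, Term.realize_relabel]
    congr 1
    funext x
    rcases x with x | x
    · exact x.elim
    · rfl
  have hmat (k l : Fin 2) {M : Type (max u v)} [L.Structure M] (v : Empty → M)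
      (xs : Fin 2 → M) : (mat k l).Realize v xs ↔
        ((τ₁.bdEqual σ₁).Realize v (fun _ => xs k) →
          (τ₂.bdEqual σ₂).Realize v fun _ => xs l) := by
    simp only [mat, BoundedFormula.realize_imp, BoundedFormula.realize_bdEqual, hren]
  have hfun {M : Type (max u v)} (xs : Fin 1 → M) : xs = fun _ => xs 0 := by
    funext k
    rw [Subsingleton.elim k 0]
  refine ⟨⟨(mat 0 1).all.ex, ?_, ?_⟩, ⟨(mat 1 0).ex.all, ?_, ?_⟩⟩
  · exact .ex (.of_isUniversal (.all (.of_isQF (hqf _ _))))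
  · intro M v xs
    rw [BoundedFormula.realize_iff, BoundedFormula.realize_imp]
    rw [realize_boundedFormula_alls, realize_boundedFormula_alls]
    simp only [BoundedFormula.realize_ex, BoundedFormula.realize_all, hmat]
    constructor
    · intro hyp
      by_cases h1 : ∀ x : Fin 1 → M, (τ₁.bdEqual σ₁).Realize v x
      · exact ⟨Classical.arbitrary M, fun y _ => hyp h1 _⟩
      · push Not at h1
        obtain ⟨x, hx⟩ := h1
        rw [hfun x] at hx
        exact ⟨x 0, fun y h2 => absurd h2 hx⟩
    · rintro ⟨x, hx⟩ h1 y
      rw [hfun y]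
      exact hx (y 0) (h1 _)
  · exact .all (.of_isExistential (.ex (.of_isQF (hqf _ _))))
  · intro M v xs
    rw [BoundedFormula.realize_iff, BoundedFormula.realize_imp]
    rw [realize_boundedFormula_alls, realize_boundedFormula_alls]
    simp only [BoundedFormula.realize_ex, BoundedFormula.realize_all, hmat]
    constructor
    · intro hyp y
      by_cases h1 : ∀ x : Fin 1 → M, (τ₁.bdEqual σ₁).Realize v x
      · exact ⟨Classical.arbitrary M, fun _ => hyp h1 _⟩
      · push Not at h1
        obtain ⟨x, hx⟩ := h1
        rw [hfun x] at hx
        exact ⟨x 0, fun h2 => absurd h2 hx⟩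
    · intro hyp h1 y
      rw [hfun y]
      obtain ⟨x, hx⟩ := hyp (y 0)
      exact hx (h1 _)

/-! ### A generic function on the injective sequences close to a base point -/

/-- Fill the holes of a partial sequence with `x`. -/
def fill {ι : Type v} {U : Type w} (q : ι → Option U) (x : U) : ι → U := fun p => (q p).getD x

section Generic

variable {α : Type u} (P : α → Prop)

/-- Sequences over `α × ℕ` with holes, indexed by a subset of `α`, that differ from the base point
`p ↦ (p, 0)` at finitely many indices only. -/
def Pattern : Type u :=
  {q : Subtype P → Option (α × ℕ) // {p : Subtype P | q p ≠ some (p.1, 0)}.Finite}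

variable (α) in
-- A pattern is determined by the finite set of its deviations from the base point, so there are at
-- most |α| patterns and at most |α| finite lists of them. Each requirement thus gets its own index
-- in α.
theorem exists_surjective_requirement [Infinite α] :
    ∃ D : α → List (Pattern P × ℕ) × ℕ, Function.Surjective D := by
  classical
  have hinj : Function.Injective fun q : Pattern P =>
      q.2.toFinset.image fun p => ((p.1, q.1 p) : α × Option (α × ℕ)) := by
    intro q q' hqq'
    have key : ∀ (r : Pattern P) (p : Subtype P) (o : Option (α × ℕ)),
        (p.1, o) ∈ (r.2.toFinset.image fun p => ((p.1, r.1 p) : α × Option (α × ℕ))) ↔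
          r.1 p = o ∧ o ≠ some (p.1, 0) := by
      intro r p o
      simp only [Finset.mem_image, Set.Finite.mem_toFinset, Set.mem_ofPred_eq, Prod.mk.injEq]
      constructor
      · rintro ⟨p', h1, h2, h3⟩
        obtain rfl : p' = p := Subtype.ext h2
        exact ⟨h3, h3 ▸ h1⟩
      · rintro ⟨rfl, h⟩
        exact ⟨p, h, rfl, rfl⟩
    apply Subtype.ext
    funext p
    simp only at hqq'
    by_cases h : q.1 p = some (p.1, 0)
    · by_contra hne
      have h' : q'.1 p ≠ some (p.1, 0) := fun e => hne (h.trans e.symm)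
      have := (key q p (q'.1 p)).1 (hqq' ▸ (key q' p _).2 ⟨rfl, h'⟩)
      exact hne this.1
    · exact ((key q' p (q.1 p)).1 (hqq' ▸ (key q p _).2 ⟨rfl, h⟩)).1.symm
  have hα : Cardinal.aleph0 ≤ Cardinal.mk α := Cardinal.aleph0_le_mk α
  have hU : Cardinal.mk (α × ℕ) = Cardinal.mk α := by
    rw [Cardinal.mk_prod, Cardinal.lift_id', Cardinal.mk_nat, Cardinal.lift_aleph0]
    exact Cardinal.mul_aleph0_eq hα
  have hO : Cardinal.mk (α × Option (α × ℕ)) = Cardinal.mk α := by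
    rw [Cardinal.mk_prod, Cardinal.lift_id, Cardinal.lift_id, Cardinal.mk_option, hU,
      Cardinal.add_one_eq hα, Cardinal.mul_eq_self hα]
  have hP : Cardinal.mk (Pattern P) ≤ Cardinal.mk α := by
    refine (Cardinal.mk_le_of_injective hinj).trans ?_
    rw [Cardinal.mk_finset_of_infinite, hO]
  have hle : Cardinal.mk (List (Pattern P × ℕ) × ℕ) ≤ Cardinal.mk α := by
    rw [Cardinal.mk_prod, Cardinal.lift_id', Cardinal.mk_nat, Cardinal.lift_aleph0]
    have h1 : Cardinal.mk (List (Pattern P × ℕ)) ≤ Cardinal.mk α := by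
      refine (Cardinal.mk_list_le_max _).trans (max_le hα ?_)
      rw [Cardinal.mk_prod, Cardinal.lift_id', Cardinal.mk_nat, Cardinal.lift_aleph0]
      exact (mul_le_mul' hP le_rfl).trans (Cardinal.mul_aleph0_eq hα).le
    exact (mul_le_mul' h1 le_rfl).trans (Cardinal.mul_aleph0_eq hα).le
  obtain ⟨f⟩ := hle
  exact ⟨Function.invFun f, Function.invFun_surjective f.injective⟩

/-- `h` vanishes off the injective sequences close to the base point, and it takes prescribed values
on every finite family of sequences obtained by filling holes with a suitable new element. -/
structure IsGeneric (h : (Subtype P → α × ℕ) → ℕ) : Prop where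
  injective : ∀ q, h q ≠ 0 → Function.Injective q
  near : ∀ q, h q ≠ 0 → {p : Subtype P | q p ≠ (p.1, 0)}.Finite
  exists_fill : ∀ {κ : Type u} [Finite κ] (q : κ → Pattern P) (c : κ → ℕ),
    (∀ k l, (q k).1 = (q l).1 → c k = c l) → ∀ B : ℕ, ∃ x : α × ℕ, B < x.2 ∧
      ∀ k, (∃ p, (q k).1 p = none) → Function.Injective (fill (q k).1 x) →
        h (fill (q k).1 x) = c k

variable (α) in
-- Requirement r, with bound N, is met by the new element (r, N + 1). Every other entry of the
-- filled sequence has second coordinate at most N, so the sequence reveals both r and the pattern,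
-- and different requirements never interfere.
theorem exists_isGeneric [Infinite α] : ∃ h : (Subtype P → α × ℕ) → ℕ, IsGeneric P h := by
  classical
  obtain ⟨D, hD⟩ := exists_surjective_requirement α P
  let M (s : Subtype P → α × ℕ) (r : α) (q : Pattern P) (n : ℕ) : Prop :=
    (q, n) ∈ (D r).1 ∧ (∀ p u, q.1 p = some u → u.2 ≤ (D r).2) ∧ (∃ p, q.1 p = none) ∧
      s = fill q.1 (r, (D r).2 + 1)
  have hM0 (s r q n) (hm : M s r q n) (p : Subtype P) :
      s p = (r, (D r).2 + 1) ∨ (s p).2 ≤ (D r).2 := by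
    obtain ⟨-, h2, -, rfl⟩ := hm
    unfold fill
    cases hp : q.1 p with
    | none => exact .inl rfl
    | some u => exact .inr (h2 p u hp)
  have hM1 (s r q n) (hm : M s r q n) : ∃ p, s p = (r, (D r).2 + 1) := by
    obtain ⟨-, -, ⟨p, hp⟩, rfl⟩ := hm
    exact ⟨p, by simp [fill, hp]⟩
  -- If s filled patterns for both r and r' with r ≠ r', each new element would lie below the bound
  -- of the other requirement.
  have hMr (s r q n r' q' n') (hm : M s r q n) (hm' : M s r' q' n') : r = r' := by
    obtain ⟨p, hp⟩ := hM1 _ _ _ _ hm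
    obtain ⟨p', hp'⟩ := hM1 _ _ _ _ hm'
    rcases hM0 _ _ _ _ hm' p with h | h
    · exact congrArg Prod.fst (hp.symm.trans h)
    · rcases hM0 _ _ _ _ hm p' with h' | h'
      · exact congrArg Prod.fst (h'.symm.trans hp')
      · rw [hp] at h
        rw [hp'] at h'
        simp only at h h'
        omega
  have hMq (s r q n q' n') (hm : M s r q n) (hm' : M s r q' n') : q.1 = q'.1 := by
    obtain ⟨-, h1, -, e⟩ := hm
    obtain ⟨-, h1', -, e'⟩ := hm'
    funext p
    have e2 := congrFun (e.symm.trans e') p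
    unfold fill at e2
    cases hp : q.1 p with
    | none =>
      cases hp' : q'.1 p with
      | none => rfl
      | some u =>
        have := h1' p u hp'
        simp only [hp, hp', Option.getD_none, Option.getD_some] at e2
        rw [← e2] at this
        simp at this
    | some u =>
      cases hp' : q'.1 p with
      | none =>
        have := h1 p u hp
        simp only [hp, hp', Option.getD_none, Option.getD_some] at e2
        rw [e2] at this
        simp at this
      | some u' =>
        simp only [hp, hp', Option.getD_some] at e2
        rw [e2]
  -- The choice is arbitrary only for inconsistent lists; for consistent ones `hMr` and `hMq` force
  -- the value.
  let h (s : Subtype P → α × ℕ) : ℕ :=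
    if hs : Function.Injective s ∧ ∃ n r q, M s r q n then hs.2.choose else 0
  refine ⟨h, ⟨?_, ?_, ?_⟩⟩
  · intro s hs
    by_contra hne
    exact hs (dif_neg fun hh => hne hh.1)
  · intro s hs
    have : ∃ n r q, M s r q n := by
      by_contra hne
      exact hs (dif_neg fun hh => hne hh.2)
    obtain ⟨n, r, q, hm⟩ := this
    refine q.2.subset ?_
    intro p hp hq
    apply hp
    rw [hm.2.2.2]
    simp [fill, hq]
  · intro κ _ q c hc B
    cases nonempty_fintype κ
    have hbound : ∃ N, B ≤ N ∧ ∀ k p u, (q k).1 p = some u → u.2 ≤ N := by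
      have h1 : ∀ k, ∃ N, ∀ p u, (q k).1 p = some u → u.2 ≤ N := by
        intro k
        have hfin := (q k).2
        refine ⟨hfin.toFinset.sup fun p => (((q k).1 p).map Prod.snd).getD 0, ?_⟩
        intro p u hpu
        by_cases hp : (q k).1 p = some (p.1, 0)
        · rw [hp] at hpu
          obtain rfl := Option.some.inj hpu
          exact Nat.zero_le _
        · have := Finset.le_sup (f := fun p => (((q k).1 p).map Prod.snd).getD 0)
            (hfin.mem_toFinset.2 hp)
          simpa [hpu] using this
      choose N hN using h1
      refine ⟨max B (Finset.univ.sup N), le_max_left _ _, fun k p u hu => ?_⟩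
      exact (hN k p u hu).trans ((Finset.le_sup (Finset.mem_univ k)).trans (le_max_right _ _))
    obtain ⟨N, hBN, hN⟩ := hbound
    obtain ⟨r, hr⟩ := hD (Finset.univ.toList.map fun k => (q k, c k), N)
    have hr2 : (D r).2 = N := by rw [hr]
    refine ⟨(r, (D r).2 + 1), by simp only [hr2]; omega, ?_⟩
    intro k hole hinj
    have hm : M (fill (q k).1 (r, (D r).2 + 1)) r (q k) (c k) := by
      refine ⟨?_, ?_, hole, rfl⟩
      · rw [hr]
        simp only [List.mem_map, Finset.mem_toList, Finset.mem_univ, true_and]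
        exact ⟨k, rfl⟩
      · rw [hr2]
        exact hN k
    have hs : Function.Injective (fill (q k).1 (r, (D r).2 + 1)) ∧
        ∃ n r' q', M (fill (q k).1 (r, (D r).2 + 1)) r' q' n := ⟨hinj, c k, r, q k, hm⟩
    have e : h (fill (q k).1 (r, (D r).2 + 1)) = hs.2.choose := dif_pos hs
    rw [e]
    have hspec := hs.2.choose_spec
    generalize hs.2.choose = n at hspec
    obtain ⟨r', q', hm'⟩ := hspec
    obtain rfl := hMr _ _ _ _ _ _ _ hm hm'
    have hq := hMq _ _ _ _ _ _ hm hm'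
    have hmem := hm'.1
    rw [hr] at hmem
    simp only [List.mem_map, Finset.mem_toList, Finset.mem_univ, true_and, Prod.mk.injEq] at hmem
    obtain ⟨l, hl, hl'⟩ := hmem
    rw [← hl']
    exact hc l k (by rw [hl, hq])

end Generic

/-! ### A back-and-forth system of finitary equivalences of sequences -/

/-- The sequence `s` differs from the base point `p ↦ (p, 0)` at finitely many indices only. -/
def Near {α : Type u} (s : α → α × ℕ) : Prop := {p | s p ≠ (p, 0)}.Finite

/-- `τ` maps `F` into itself and fixes every other index. -/
def IsEndoOn {α : Type u} (F : Finset α) (τ : α → α) : Prop :=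
  (∀ p ∉ F, τ p = p) ∧ ∀ p ∈ F, τ p ∈ F

section Near

variable {α : Type u} {s s' : α → α × ℕ} {F : Finset α} {τ : α → α}

theorem Near.congr (hs : Near s) (h : ∀ p ∉ F, s p = s' p) : Near s' := by
  refine (hs.union F.finite_toSet).subset fun p hp => ?_
  by_cases hpF : p ∈ F
  · exact .inr hpF
  · refine .inl ?_
    change s p ≠ _
    rw [h p hpF]
    exact hp

theorem near_congr (h : ∀ p ∉ F, s p = s' p) : Near s ↔ Near s' :=
  ⟨fun hs => hs.congr h, fun hs => hs.congr fun p hp => (h p hp).symm⟩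

theorem Near.exists_bound (hs : Near s) : ∃ B, ∀ p, (s p).2 ≤ B := by
  refine ⟨hs.toFinset.sup fun p => (s p).2, fun p => ?_⟩
  by_cases hp : s p = (p, 0)
  · rw [hp]
    exact Nat.zero_le _
  · exact Finset.le_sup (f := fun p => (s p).2) (hs.mem_toFinset.2 hp)

theorem IsEndoOn.near_comp (hτ : IsEndoOn F τ) : Near (s ∘ τ) ↔ Near s :=
  near_congr (F := F) fun p hp => by simp [hτ.1 p hp]

theorem IsEndoOn.comp {σ : α → α} (hτ : IsEndoOn F τ) (hσ : IsEndoOn F σ) :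
    IsEndoOn F (τ ∘ σ) :=
  ⟨fun p hp => by simp [hσ.1 p hp, hτ.1 p hp], fun p hp => hτ.2 _ (hσ.2 p hp)⟩

end Near

/-! ### Heights of sequences and of their substitutes -/

section Height

variable {α : Type u} {b c : α} (h : ({p : α // p ≠ b ∧ p ≠ c} → α × ℕ) → ℕ)

/-- The value of `h` at the restriction of a sequence to the indices other than `b` and `c`. -/
def height (s : α → α × ℕ) : ℕ := h fun p => s p.1

/-- `s` is injective off the indices `b` and `c`. -/
def InjOff {α : Type u} (b c : α) {β : Type v} (s : α → β) : Prop :=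
  ∀ p q, p ≠ b → p ≠ c → q ≠ b → q ≠ c → s p = s q → p = q

variable {h}

theorem height_congr {s s' : α → α × ℕ} (hs : ∀ p, p ≠ b → p ≠ c → s p = s' p) :
    height h s = height h s' := by
  unfold height
  congr 1
  funext p
  exact hs p.1 p.2.1 p.2.2

variable (hh : IsGeneric (fun p => p ≠ b ∧ p ≠ c) h)

include hh

theorem IsGeneric.injOff {s : α → α × ℕ} (hs : height h s ≠ 0) : InjOff b c s := by
  intro p q hpb hpc hqb hqc e
  have hinj := hh.injective _ hs
  exact congrArg Subtype.val (@hinj ⟨p, hpb, hpc⟩ ⟨q, hqb, hqc⟩ e)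

theorem IsGeneric.height_eq_zero {s : α → α × ℕ} (hs : ¬ InjOff b c s) : height h s = 0 := by
  by_contra hne
  exact hs (hh.injOff hne)

theorem IsGeneric.height_eq_zero_of_not_near {s : α → α × ℕ} (hs : ¬ Near s) :
    height h s = 0 := by
  by_contra hne
  refine hs ((((hh.near _ hne).image Subtype.val).union (Set.toFinite {b, c})).subset ?_)
  intro p hp
  by_cases hpbc : p ≠ b ∧ p ≠ c
  · exact .inl ⟨⟨p, hpbc⟩, hp, rfl⟩
  · refine .inr ?_
    simp only [Set.mem_insert_iff, Set.mem_singleton_iff]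
    tauto

theorem IsGeneric.exists_height_fill {κ : Type u} [Finite κ] (q : κ → α → Option (α × ℕ))
    (hq : ∀ k, {p | q k p ≠ some (p, 0)}.Finite) (v : κ → ℕ)
    (hv : ∀ k l, (∀ p, p ≠ b → p ≠ c → q k p = q l p) → v k = v l) (B : ℕ) :
    ∃ x : α × ℕ, B < x.2 ∧ ∀ k, (∃ p, p ≠ b ∧ p ≠ c ∧ q k p = none) →
      InjOff b c (fill (q k) x) → height h (fill (q k) x) = v k := by
  obtain ⟨x, hx, hx'⟩ := hh.exists_fill
    (fun k => (⟨fun p => q k p.1, (hq k).preimage Subtype.val_injective.injOn⟩ :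
      Pattern fun p => p ≠ b ∧ p ≠ c)) v
    (fun k l e => hv k l fun p hb hc => congrFun e ⟨p, hb, hc⟩) B
  refine ⟨x, hx, fun k hk hinj => hx' k ?_ ?_⟩
  · obtain ⟨p, hb, hc, hp⟩ := hk
    exact ⟨⟨p, hb, hc⟩, hp⟩
  · intro p p' e
    exact Subtype.ext (hinj p.1 p'.1 p.2.1 p.2.2 p'.2.1 p'.2.2 e)

/-- A new element `x` can be put into the holes of finitely many partial sequences `o β` in such a
way that all the substitutes by transformations of `F` get prescribed heights. -/
theorem IsGeneric.exists_height_fill_comp {ι : Type} [Finite ι] {F : Finset α}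
    (o : ι → α → Option (α × ℕ)) (t : ι → α → α × ℕ)
    (ho : ∀ β, {p | o β p ≠ some (p, 0)}.Finite)
    (hot : ∀ β β' τ τ', IsEndoOn F τ → IsEndoOn F τ' →
      (∀ p, p ≠ b → p ≠ c → o β (τ p) = o β' (τ' p)) →
      height h (t β ∘ τ) = height h (t β' ∘ τ')) (B : ℕ) :
    ∃ x : α × ℕ, B < x.2 ∧ ∀ β τ, IsEndoOn F τ → (∃ p, p ≠ b ∧ p ≠ c ∧ o β (τ p) = none) →
      InjOff b c (fill (o β) x ∘ τ) → height h (fill (o β) x ∘ τ) = height h (t β ∘ τ) := by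
  classical
  -- A transformation of F is determined by its restriction to F, so only finitely many heights are
  -- prescribed.
  let ext (τ : F → F) : α → α := fun p => if hp : p ∈ F then (τ ⟨p, hp⟩).1 else p
  have hext (τ : F → F) : IsEndoOn F (ext τ) := by
    refine ⟨fun p hp => dif_neg hp, fun p hp => ?_⟩
    simp only [ext, dif_pos hp]
    exact (τ ⟨p, hp⟩).2
  have hfin (k : (F → F) × ULift.{u} ι) : {p | (o k.2.down ∘ ext k.1) p ≠ some (p, 0)}.Finite := by
    refine ((ho k.2.down).union F.finite_toSet).subset fun p hp => ?_
    by_cases hpF : p ∈ F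
    · exact .inr hpF
    · refine .inl ?_
      have hp' : o k.2.down (ext k.1 p) ≠ some (p, 0) := hp
      rwa [(hext k.1).1 p hpF] at hp'
  obtain ⟨x, hx, hx'⟩ := hh.exists_height_fill (κ := (F → F) × ULift.{u} ι)
    (fun k => o k.2.down ∘ ext k.1) hfin (fun k => height h (t k.2.down ∘ ext k.1))
    (fun k l e => hot _ _ _ _ (hext _) (hext _) e) B
  refine ⟨x, hx, fun β τ hτ hole hinj => ?_⟩
  have e : ext (fun p => ⟨τ p.1, hτ.2 p.1 p.2⟩) = τ := by
    funext p
    by_cases hp : p ∈ F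
    · simp only [ext, dif_pos hp]
    · simp only [ext, dif_neg hp, hτ.1 p hp]
  have := hx' (fun p => ⟨τ p.1, hτ.2 p.1 p.2⟩, ⟨β⟩)
  simp only [e] at this
  exact this hole hinj

end Height

/-! #### The equivalences -/

section Sim

variable {α : Type u}

/-- `s` and `s'` agree off `F`, satisfy the same equalities on `F` and, close to the base point,
take values of `s` off `F` at the same indices in `F`. -/
structure SimCore (F : Finset α) (s s' : α → α × ℕ) : Prop where
  off : ∀ p ∉ F, s p = s' p
  ker : ∀ p ∈ F, ∀ q ∈ F, s p = s q ↔ s' p = s' q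
  mem : Near s → ∀ p ∈ F, (∃ q ∉ F, s p = s q) ↔ ∃ q ∉ F, s' p = s' q

variable {b c : α} (h : ({p : α // p ≠ b ∧ p ≠ c} → α × ℕ) → ℕ)

/-- In addition, all the substitutes by transformations of `F` have the same heights. -/
structure Sim (F : Finset α) (s s' : α → α × ℕ) : Prop extends SimCore F s s' where
  height_comp : ∀ τ, IsEndoOn F τ → height h (s ∘ τ) = height h (s' ∘ τ)

variable {h} {F : Finset α} {s s' : α → α × ℕ} {τ : α → α}

theorem SimCore.near_iff (hs : SimCore F s s') : Near s ↔ Near s' := near_congr hs.off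

theorem SimCore.symm (hs : SimCore F s s') : SimCore F s' s where
  off p hp := (hs.off p hp).symm
  ker p hp q hq := (hs.ker p hp q hq).symm
  mem hn p hp := (hs.mem (hs.near_iff.2 hn) p hp).symm

theorem Sim.symm (hs : Sim h F s s') : Sim h F s' s where
  toSimCore := hs.toSimCore.symm
  height_comp τ hτ := (hs.height_comp τ hτ).symm

theorem SimCore.comp (hs : SimCore F s s') (hτ : IsEndoOn F τ) :
    SimCore F (s ∘ τ) (s' ∘ τ) where
  off p hp := by simp [hτ.1 p hp, hs.off p hp]
  ker p hp q hq := hs.ker _ (hτ.2 p hp) _ (hτ.2 q hq)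
  mem hn p hp := by
    have := hs.mem (hτ.near_comp.1 hn) _ (hτ.2 p hp)
    constructor
    · rintro ⟨q, hq, e⟩
      obtain ⟨q', hq', e'⟩ := this.1 ⟨q, hq, by simpa [hτ.1 q hq] using e⟩
      exact ⟨q', hq', by simpa [hτ.1 q' hq'] using e'⟩
    · rintro ⟨q, hq, e⟩
      obtain ⟨q', hq', e'⟩ := this.2 ⟨q, hq, by simpa [hτ.1 q hq] using e⟩
      exact ⟨q', hq', by simpa [hτ.1 q' hq'] using e'⟩

theorem Sim.comp (hs : Sim h F s s') (hτ : IsEndoOn F τ) : Sim h F (s ∘ τ) (s' ∘ τ) where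
  toSimCore := hs.toSimCore.comp hτ
  height_comp _ hσ := hs.height_comp _ (hτ.comp hσ)

/-- A repetition in s' ∘ τ lies within F, outside F, or across; the three clauses of `SimCore`
transfer each kind. Indices outside F are never b or c. -/
theorem SimCore.injOff_comp (hs : SimCore F s s') (hn : Near s) (hb : b ∈ F) (hc : c ∈ F)
    (hτ : IsEndoOn F τ) (hi : InjOff b c (s ∘ τ)) : InjOff b c (s' ∘ τ) := by
  have hne : ∀ q ∉ F, q ≠ b ∧ q ≠ c := fun q hq =>
    ⟨fun e => hq (e ▸ hb), fun e => hq (e ▸ hc)⟩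
  have mixed : ∀ p q, p ≠ b → p ≠ c → p ∈ F → q ∉ F → s' (τ p) ≠ s' (τ q) := by
    intro p q hpb hpc hp hq e
    rw [hτ.1 q hq] at e
    obtain ⟨q', hq', e'⟩ := (hs.mem hn _ (hτ.2 p hp)).2 ⟨q, hq, e⟩
    have := hi p q' hpb hpc (hne q' hq').1 (hne q' hq').2 (by simpa [hτ.1 q' hq'] using e')
    exact hq' (this ▸ hp)
  intro p q hpb hpc hqb hqc e
  simp only [Function.comp_apply] at e
  by_cases hp : p ∈ F
  · by_cases hq : q ∈ F
    · exact hi p q hpb hpc hqb hqc ((hs.ker _ (hτ.2 p hp) _ (hτ.2 q hq)).2 e)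
    · exact absurd e (mixed p q hpb hpc hp hq)
  · by_cases hq : q ∈ F
    · exact absurd e.symm (mixed q p hqb hqc hq hp)
    · refine hi p q hpb hpc hqb hqc ?_
      simp only [Function.comp_apply, hτ.1 p hp, hτ.1 q hq] at e ⊢
      rw [hs.off p hp, hs.off q hq, e]

/-- Heights need comparing only near the base point and when both substitutes are injective off b
and c; otherwise both vanish. -/
theorem SimCore.height_comp_eq (hs : SimCore F s s')
    (hh : IsGeneric (fun p => p ≠ b ∧ p ≠ c) h) (hb : b ∈ F) (hc : c ∈ F) (hτ : IsEndoOn F τ)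
    (H : Near s → InjOff b c (s ∘ τ) → InjOff b c (s' ∘ τ) →
      height h (s ∘ τ) = height h (s' ∘ τ)) :
    height h (s ∘ τ) = height h (s' ∘ τ) := by
  by_cases hn : Near s
  · by_cases hi : InjOff b c (s ∘ τ)
    · exact H hn hi (hs.injOff_comp hn hb hc hτ hi)
    · have hi' : ¬ InjOff b c (s' ∘ τ) := fun hi' =>
        hi (hs.symm.injOff_comp (hs.near_iff.1 hn) hb hc hτ hi')
      rw [hh.height_eq_zero hi, hh.height_eq_zero hi']
  · have hn' : ¬ Near s' := fun hn' => hn (hs.near_iff.2 hn')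
    rw [hh.height_eq_zero_of_not_near fun e => hn (hτ.near_comp.1 e),
      hh.height_eq_zero_of_not_near fun e => hn' (hτ.near_comp.1 e)]

variable [DecidableEq α]

theorem near_update {j : α} {x : α × ℕ} : Near (Function.update s j x) ↔ Near s :=
  near_congr (F := {j}) fun p hp => Function.update_of_ne (by simpa using hp) _ _

theorem SimCore.update (hs : SimCore F s s') {j : α} (hj : j ∈ F) {x x' : α × ℕ}
    (hx : ∀ p ∈ F, p ≠ j → (s p = x ↔ s' p = x'))
    (hm : Near s → ((∃ q ∉ F, x = s q) ↔ ∃ q ∉ F, x' = s' q)) :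
    SimCore F (Function.update s j x) (Function.update s' j x') := by
  have hne : ∀ q ∉ F, q ≠ j := fun q hq e => hq (e ▸ hj)
  refine ⟨fun p hp => ?_, fun p hp q hq => ?_, fun hn p hp => ?_⟩
  · simp [hne p hp, hs.off p hp]
  · by_cases hpj : p = j
    · by_cases hqj : q = j
      · simp [hpj, hqj]
      · subst hpj
        simp only [Function.update_self, Function.update_of_ne hqj]
        rw [eq_comm, hx q hq hqj, eq_comm]
    · by_cases hqj : q = j
      · subst hqj
        simp only [Function.update_self, Function.update_of_ne hpj]
        exact hx p hp hpj
      · simp only [Function.update_of_ne hpj, Function.update_of_ne hqj]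
        exact hs.ker p hp q hq
  · have key : ∀ (f : α → α × ℕ) (y z : α × ℕ), (∃ q ∉ F, z = Function.update f j y q) ↔
        ∃ q ∉ F, z = f q := by
      intro f y z
      refine exists_congr fun q => and_congr_right fun hq => ?_
      rw [Function.update_of_ne (hne q hq)]
    rw [key, key]
    rw [near_update] at hn
    by_cases hpj : p = j
    · subst hpj
      simpa using hm hn
    · simpa [hpj] using hs.mem hn p hp

/-- This is the back-and-forth step. The answer x' depends on whether x already occurs on F, and,
near the base point, on whether it occurs outside F. -/
theorem Sim.exists_update [Infinite α] (hh : IsGeneric (fun p => p ≠ b ∧ p ≠ c) h) (hb : b ∈ F)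
    (hc : c ∈ F) (hs : Sim h F s s') {j : α} (hj : j ∈ F) (x : α × ℕ) :
    ∃ x', Sim h F (Function.update s j x) (Function.update s' j x') := by
  by_cases hA : ∃ k ∈ F, x = s k
  · obtain ⟨k, hk, rfl⟩ := hA
    refine ⟨s' k, ?_⟩
    -- Copying the entry at k to j is itself a substitution, as transformations of F need not be
    -- injective.
    have hτ : IsEndoOn F (Function.update id j k) := by
      refine ⟨fun p hp => ?_, fun p hp => ?_⟩
      · rw [Function.update_of_ne (show p ≠ j from fun e => hp (e ▸ hj))]
        rfl
      · by_cases hpj : p = j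
        · simpa [hpj] using hk
        · simpa [hpj] using hp
    have := hs.comp hτ
    rwa [Function.comp_update, Function.comp_update] at this
  push Not at hA
  have hA' : ∀ p ∈ F, s p ≠ x := fun p hp e => hA p hp e.symm
  by_cases hn : Near s
  swap
  -- Away from the base point all heights vanish, so x' only has to be new on F.
  · obtain ⟨x', hx'⟩ := Infinite.exists_notMem_finset (F.image s')
    have hx'' : ∀ p ∈ F, s' p ≠ x' := fun p hp e => hx' (Finset.mem_image.2 ⟨p, hp, e⟩)
    have core : SimCore F (Function.update s j x) (Function.update s' j x') :=
      hs.toSimCore.update hj (fun p hp _ => by simp [hA' p hp, hx'' p hp]) fun hn' => absurd hn' hn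
    exact ⟨x', core, fun τ hτ => core.height_comp_eq hh hb hc hτ
      fun hn' => absurd (near_update.1 hn') hn⟩
  have hn' := hs.near_iff.1 hn
  have avoid : ∀ (f : α → α × ℕ) (y : α × ℕ) (τ : α → α), (¬ ∃ p, p ≠ b ∧ p ≠ c ∧ τ p = j) →
      height h (Function.update f j y ∘ τ) = height h (f ∘ τ) := by
    intro f y τ hτ
    apply height_congr
    intro p hpb hpc
    simp only [Function.comp_apply]
    rw [Function.update_of_ne fun e => hτ ⟨p, hpb, hpc, e⟩]
  by_cases hC : ∃ q ∉ F, x = s q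
  · obtain ⟨q₀, hq₀, rfl⟩ := hC
    -- All but finitely many indices q₁ still carry the base entry (q₁, 0), so one outside F can be
    -- found whose entry is missing from s'(F).
    have hfin : ((F : Set α) ∪ {p | s p ≠ (p, 0)} ∪ ((F.image fun p => (s' p).1 : Finset α) :
        Set α)).Finite := (F.finite_toSet.union hn).union (Finset.finite_toSet _)
    obtain ⟨q₁, hq₁⟩ := hfin.infinite_compl.nonempty
    simp only [Set.mem_compl_iff, Set.mem_union, Finset.mem_coe, Set.mem_ofPred_eq,
      Finset.mem_image, not_or, not_not, not_exists, not_and] at hq₁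
    obtain ⟨⟨hq₁F, hq₁s⟩, hq₁'⟩ := hq₁
    have hx'' : ∀ p ∈ F, s' p ≠ s' q₁ := by
      intro p hp e
      apply hq₁' p hp
      rw [e, ← hs.off q₁ hq₁F, hq₁s]
    have core : SimCore F (Function.update s j (s q₀)) (Function.update s' j (s' q₁)) :=
      hs.toSimCore.update hj (fun p hp _ => by simp [hA' p hp, hx'' p hp])
        fun _ => ⟨fun _ => ⟨q₁, hq₁F, rfl⟩, fun _ => ⟨q₀, hq₀, rfl⟩⟩
    refine ⟨s' q₁, core, fun τ hτ => core.height_comp_eq hh hb hc hτ fun _ hi _ => ?_⟩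
    -- A substitute that uses j repeats the entry at q₀ and is not injective; any other does not see
    -- the change.
    by_cases hp : ∃ p, p ≠ b ∧ p ≠ c ∧ τ p = j
    · obtain ⟨p, hpb, hpc, hpj⟩ := hp
      have hqj : q₀ ≠ j := fun e => hq₀ (e ▸ hj)
      have := hi p q₀ hpb hpc (fun e => hq₀ (e ▸ hb)) (fun e => hq₀ (e ▸ hc))
        (by simp [hpj, hτ.1 q₀ hq₀, hqj])
      subst this
      rw [hτ.1 _ hq₀] at hpj
      exact absurd hpj hqj
    · rw [avoid _ _ _ hp, avoid _ _ _ hp, hs.height_comp τ hτ]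
  -- Here x is new everywhere. Make j a hole of s' and prescribe the heights that x produces; a
  -- second coordinate above B makes x' new for s'.
  · obtain ⟨B, hB⟩ := hn'.exists_bound
    have ho : {p | Function.update (fun p => some (s' p)) j none p ≠ some (p, 0)}.Finite := by
      refine (hn'.union (Set.finite_singleton j)).subset fun p hp => ?_
      by_cases hpj : p = j
      · exact .inr hpj
      · refine .inl fun e => hp ?_
        simp [hpj, e]
    have hot (τ τ' : α → α) (hτ : IsEndoOn F τ) (hτ' : IsEndoOn F τ')
        (e : ∀ p, p ≠ b → p ≠ c → Function.update (fun p => some (s' p)) j none (τ p) =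
          Function.update (fun p => some (s' p)) j none (τ' p)) :
        height h (Function.update s j x ∘ τ) = height h (Function.update s j x ∘ τ') := by
      apply height_congr
      intro p hpb hpc
      have e' := e p hpb hpc
      simp only [Function.comp_apply]
      by_cases hp : p ∈ F
      · by_cases h1 : τ p = j <;> by_cases h2 : τ' p = j
        · rw [h1, h2]
        · simp [h1, h2] at e'
        · simp [h1, h2] at e'
        · simp only [Function.update_of_ne h1, Function.update_of_ne h2, Option.some.injEq] at e' ⊢
          exact (hs.ker _ (hτ.2 p hp) _ (hτ'.2 p hp)).2 e'
      · rw [hτ.1 p hp, hτ'.1 p hp]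
    obtain ⟨x', hx', hx''⟩ := hh.exists_height_fill_comp (F := F)
      (fun _ : Unit => Function.update (fun p => some (s' p)) j none)
      (fun _ => Function.update s j x) (fun _ => ho) (fun _ _ => hot) B
    have hne : ∀ p, s' p ≠ x' := fun p e => by
      have := hB p
      rw [e] at this
      omega
    have core : SimCore F (Function.update s j x) (Function.update s' j x') :=
      hs.toSimCore.update hj (fun p hp _ => by simp [hA' p hp, hne p]) fun _ =>
        ⟨fun e => absurd e hC, fun ⟨q, _, e⟩ => absurd e.symm (hne q)⟩
    refine ⟨x', core, fun τ hτ => core.height_comp_eq hh hb hc hτ fun _ _ hi => ?_⟩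
    by_cases hp : ∃ p, p ≠ b ∧ p ≠ c ∧ τ p = j
    · have e : fill (Function.update (fun p => some (s' p)) j none) x' =
          Function.update s' j x' := by
        funext p
        unfold fill
        by_cases hpj : p = j
        · simp [hpj]
        · simp [hpj]
      have key := hx'' () τ hτ
      rw [e] at key
      obtain ⟨p, hpb, hpc, hpj⟩ := hp
      exact (key ⟨p, hpb, hpc, by simp [hpj]⟩ hi).symm
    · rw [avoid _ _ _ hp, avoid _ _ _ hp, hs.height_comp τ hτ]

end Sim

/-! ### The full set algebra with unit a single space -/

section Full

variable {α : Type u} {U : Type u}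

theorem isDisjointUnionOfSpaces_univ : IsDisjointUnionOfSpaces (Set.univ : Set (α → U)) := by
  refine ⟨{Set.univ}, Set.pairwiseDisjoint_singleton _ _, ?_⟩
  simp [cartesianSpace]

theorem mem_add {V : Set (α → U)} {Z W : FullSetAlgebra V} {s : V} :
    s ∈ (add α Z W : Set V) ↔ s ∈ Z ∨ s ∈ W := Iff.rfl

theorem mem_neg {V : Set (α → U)} {Z : FullSetAlgebra V} {s : V} :
    s ∈ (neg α Z : Set V) ↔ s ∉ Z := Iff.rfl

theorem mem_diag {V : Set (α → U)} {i j : α} {s : V} :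
    s ∈ (diag (FullSetAlgebra V) i j : Set V) ↔ s.1 i = s.1 j := Iff.rfl

/-- A sequence as a point of the unit `^αU`. -/
def point (s : α → U) : (Set.univ : Set (α → U)) := ⟨s, trivial⟩

theorem mem_cyl [DecidableEq α] {Z : FullSetAlgebra (Set.univ : Set (α → U))} {i : α}
    {s : α → U} :
    point s ∈ (cyl i Z : Set _) ↔ ∃ x, point (Function.update s i x) ∈ Z := by
  change (∃ t ∈ Z, ∀ j, j ≠ i → s j = t.1 j) ↔ _
  constructor
  · rintro ⟨t, ht, e⟩
    refine ⟨t.1 i, ?_⟩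
    have : point (Function.update s i (t.1 i)) = t := by
      apply Subtype.ext
      funext j
      by_cases hj : j = i
      · subst hj
        simp [point]
      · simp [point, hj, e j hj]
    rwa [this]
  · rintro ⟨x, hx⟩
    exact ⟨_, hx, fun j hj => by simp [point, hj]⟩

end Full

/-! ### Invariant sets -/

section Invariant

variable {α : Type u} {b c : α} (h : ({p : α // p ≠ b ∧ p ≠ c} → α × ℕ) → ℕ)

/-- The set of sequences `Z` is invariant under all the equivalences with large support. -/
def IsInvariant (Z : FullSetAlgebra (Set.univ : Set (α → α × ℕ))) : Prop :=
  ∃ F₀ : Finset α, ∀ F, F₀ ⊆ F → b ∈ F → c ∈ F → ∀ s s', Sim h F s s' → point s ∈ Z → point s' ∈ Z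

variable {h}

/-- The invariant sets form a subalgebra of the full set algebra. -/
def invariantAlgebra [Infinite α] (hh : IsGeneric (fun p => p ≠ b ∧ p ≠ c) h) :
    (lang α).Substructure (FullSetAlgebra (Set.univ : Set (α → α × ℕ))) where
  carrier := {Z | IsInvariant h Z}
  fun_mem {n} f ts hts := by
    classical
    change OpSymb α n at f
    change ∀ k, IsInvariant h (ts k) at hts
    change IsInvariant h _
    cases f with
    | add =>
      obtain ⟨F₀, hF₀⟩ := hts 0
      obtain ⟨F₁, hF₁⟩ := hts 1
      refine ⟨F₀ ∪ F₁, fun F hF hb hc s s' hs hm => ?_⟩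
      rw [funMap_add, mem_add] at hm ⊢
      exact hm.imp (hF₀ F (Finset.union_subset_left hF) hb hc s s' hs)
        (hF₁ F (Finset.union_subset_right hF) hb hc s s' hs)
    | neg =>
      obtain ⟨F₀, hF₀⟩ := hts 0
      refine ⟨F₀, fun F hF hb hc s s' hs hm => ?_⟩
      rw [funMap_neg, mem_neg] at hm ⊢
      exact fun hm' => hm (hF₀ F hF hb hc s' s hs.symm hm')
    | cyl i =>
      obtain ⟨F₀, hF₀⟩ := hts 0
      -- Having i in F makes the back-and-forth step available at i.
      refine ⟨insert i F₀, fun F hF hb hc s s' hs hm => ?_⟩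
      rw [funMap_cyl, mem_cyl] at hm ⊢
      obtain ⟨x, hx⟩ := hm
      rw [Finset.insert_subset_iff] at hF
      obtain ⟨x', hs'⟩ := hs.exists_update hh hb hc hF.1 x
      exact ⟨x', hF₀ F hF.2 hb hc _ _ hs' hx⟩
    | diag i j =>
      refine ⟨{i, j}, fun F hF hb hc s s' hs hm => ?_⟩
      rw [funMap_diag, mem_diag] at hm ⊢
      exact (hs.ker i (hF (by simp)) j (hF (by simp))).1 hm

variable (h) in
/-- The sequences whose height increases when the entries at `a` and `b` are interchanged. -/
def heightLt [DecidableEq α] (a : α) : FullSetAlgebra (Set.univ : Set (α → α × ℕ)) :=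
  {s : (Set.univ : Set (α → α × ℕ)) | height h s.1 < height h (s.1 ∘ Equiv.swap a b)}

/-- The identity and the transposition of a and b are transformations of F, so `Sim` preserves both
heights being compared. -/
theorem isInvariant_heightLt [DecidableEq α] (a : α) : IsInvariant h (heightLt h a) := by
  refine ⟨{a}, fun F hF hb hc s s' hs hm => ?_⟩
  have ha : a ∈ F := hF (by simp)
  have h1 : IsEndoOn F (Equiv.swap a b) := by
    refine ⟨fun p hp => Equiv.swap_apply_of_ne_of_ne (fun e => hp (e ▸ ha)) fun e => hp (e ▸ hb),
      fun p hp => ?_⟩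
    by_cases hpa : p = a
    · simpa [hpa] using hb
    · by_cases hpb : p = b
      · simpa [hpb] using ha
      · rwa [Equiv.swap_apply_of_ne_of_ne hpa hpb]
  have h2 : IsEndoOn F (id : α → α) := ⟨fun _ _ => rfl, fun _ hp => hp⟩
  have e1 := hs.height_comp _ h1
  have e2 := hs.height_comp _ h2
  change height h s < height h (s ∘ Equiv.swap a b) at hm
  change height h s' < height h (s' ∘ Equiv.swap a b)
  rw [← e1]
  exact lt_of_eq_of_lt e2.symm hm

end Invariant

/-! ### An equation that excludes serial strict orders -/

section Equation

variable {α : Type u}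

/-- The term `x + y`. -/
def addTerm {β : Type v} (x y : (lang α).Term β) : (lang α).Term β :=
  Functions.apply₂ (L := lang α) (OpSymb.add (α := α)) x y

/-- The term `-x`. -/
def negTerm {β : Type v} (x : (lang α).Term β) : (lang α).Term β :=
  Functions.apply₁ (L := lang α) (OpSymb.neg (α := α)) x

/-- The term `x · y`. -/
def infTerm {β : Type v} (x y : (lang α).Term β) : (lang α).Term β :=
  negTerm (addTerm (negTerm x) (negTerm y))

/-- The term `d_{ij}`. -/
def diagTerm (β : Type v) (i j : α) : (lang α).Term β :=
  Term.func (L := lang α) (OpSymb.diag i j) ![]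

/-- The equation `serialOrderTerm a b c x = 1` says that no section of `x` in the directions
`a, b, c` is independent of `c` and a serial strict order in the directions `a, b`. -/
def serialOrderTerm {β : Type v} (a b c : α) (x : (lang α).Term β) : (lang α).Term β :=
  let y := cylTerm b (infTerm (diagTerm β b c) x)
  let z := cylTerm a (infTerm (diagTerm β a b) y)
  cylTerm a <| cylTerm b <| cylTerm c <| addTerm
    (addTerm (infTerm (cylTerm c x) (negTerm x)) (infTerm (diagTerm β a b) x))
    (addTerm (negTerm (cylTerm b x)) (infTerm (infTerm x z) (negTerm y)))

theorem ind_func {β : Type v} {n : ℕ} (f : OpSymb α n) (ts : Fin n → (lang α).Term β) :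
    ind (Term.func (L := lang α) f ts) = OpSymb.ind f ∪ ⋃ k, ind (ts k) := by
  simp only [ind]

theorem ind_addTerm {β : Type v} (x y : (lang α).Term β) : ind (addTerm x y) = ind x ∪ ind y := by
  refine (ind_func .add _).trans ?_
  ext i
  simp [OpSymb.ind, Fin.exists_fin_two]

theorem ind_negTerm {β : Type v} (x : (lang α).Term β) : ind (negTerm x) = ind x := by
  refine (ind_func .neg _).trans ?_
  ext i
  simp [OpSymb.ind]

theorem ind_cylTerm {β : Type v} (i : α) (x : (lang α).Term β) :
    ind (cylTerm i x) = {i} ∪ ind x := by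
  refine (ind_func (.cyl i) _).trans ?_
  ext i
  simp [OpSymb.ind]

theorem ind_diagTerm (β : Type v) (i j : α) : ind (diagTerm β i j) = {i, j} := by
  refine (ind_func (.diag i j) _).trans ?_
  ext i
  simp [OpSymb.ind]

theorem ind_serialOrderTerm_subset {β : Type v} (a b c : α) (x : β) :
    ind (serialOrderTerm a b c (Term.var x : (lang α).Term β)) ⊆ {a, b, c} := by
  intro i
  simp only [serialOrderTerm, infTerm, ind_addTerm, ind_negTerm, ind_cylTerm, ind_diagTerm,
    ind, Set.mem_union, Set.mem_insert_iff, Set.mem_singleton_iff, Set.mem_empty_iff_false]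
  tauto

variable {A : Type w} [(lang α).Structure A] {β : Type v} (v : β → A)

theorem realize_addTerm (x y : (lang α).Term β) :
    (addTerm x y).realize v = add α (x.realize v) (y.realize v) := by
  unfold addTerm add
  exact Term.realize_functions_apply₂

theorem realize_negTerm (x : (lang α).Term β) :
    (negTerm x).realize v = neg α (x.realize v) := by
  unfold negTerm neg
  exact Term.realize_functions_apply₁

theorem realize_diagTerm (i j : α) : (diagTerm β i j).realize v = diag A i j := by
  exact funMap_diag i j _

end Equation

/-! ### The equation read in a full set algebra -/

section EquationInSetAlgebra

variable {α : Type u} {U : Type u} {β : Type v}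
  {v : β → FullSetAlgebra (Set.univ : Set (α → U))}

theorem mem_realize_infTerm {x y : (lang α).Term β} {s : (Set.univ : Set (α → U))} :
    s ∈ ((infTerm x y).realize v : Set _) ↔ s ∈ (x.realize v : Set _) ∧
      s ∈ (y.realize v : Set _) := by
  unfold infTerm
  rw [realize_negTerm, mem_neg, realize_addTerm, mem_add, realize_negTerm, mem_neg,
    realize_negTerm, mem_neg]
  tauto

variable [DecidableEq α]

/-- At the sequence `s`, the set `Z` is not locally a serial strict order. -/
def OrderFailsAt (a b c : α) (Z : FullSetAlgebra (Set.univ : Set (α → U))) (s : α → U) : Prop :=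
  (((∃ x, point (Function.update s c x) ∈ Z) ∧ point s ∉ Z) ∨ (s a = s b ∧ point s ∈ Z)) ∨
    ((¬ ∃ x, point (Function.update s b x) ∈ Z) ∨
      ((point s ∈ Z ∧ point (Function.update (Function.update s a (s b)) b (s c)) ∈ Z) ∧
        point (Function.update s b (s c)) ∉ Z))

/-- The inner terms y and z are substitutions: y asks about (s_a, s_c), z about (s_b, s_c), so the
last summand is a failure of transitivity. The constant d_aa serves as 1. -/
theorem realize_serialOrderTerm_eq_iff {a b c : α} (hab : a ≠ b) (hac : a ≠ c) (hbc : b ≠ c)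
    (x : (lang α).Term β) :
    (serialOrderTerm a b c x).realize v = (diagTerm β a a).realize v ↔
      ∀ s, ∃ u₁ u₂ u₃, OrderFailsAt a b c (x.realize v)
        (Function.update (Function.update (Function.update s a u₁) b u₂) c u₃) := by
  have hy : ∀ s : α → U,
      point s ∈ ((cylTerm b (infTerm (diagTerm β b c) x)).realize v : Set _) ↔
      point (Function.update s b (s c)) ∈ (x.realize v : Set _) := by
    intro s
    rw [realize_cylTerm, mem_cyl]
    simp only [mem_realize_infTerm, realize_diagTerm, mem_diag]
    simp only [point, Function.update_self, Function.update_of_ne hbc.symm]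
    exact ⟨fun ⟨_, e, hx⟩ => e ▸ hx, fun hx => ⟨_, rfl, hx⟩⟩
  have hz : ∀ s : α → U, point s ∈ ((cylTerm a (infTerm (diagTerm β a b)
      (cylTerm b (infTerm (diagTerm β b c) x)))).realize v : Set _) ↔
      point (Function.update (Function.update s a (s b)) b (s c)) ∈ (x.realize v : Set _) := by
    intro s
    rw [realize_cylTerm, mem_cyl]
    simp only [mem_realize_infTerm, hy, realize_diagTerm, mem_diag]
    simp only [point, Function.update_self, Function.update_of_ne hab.symm,
      Function.update_of_ne hac.symm]
    exact ⟨fun ⟨_, e, hx⟩ => e ▸ hx, fun hx => ⟨_, rfl, hx⟩⟩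
  have hset : ∀ W : FullSetAlgebra (Set.univ : Set (α → U)),
      W = (diagTerm β a a).realize v ↔ ∀ s, point s ∈ W := by
    intro W
    constructor
    · rintro rfl s
      rw [realize_diagTerm, mem_diag]
    · intro hW
      apply Set.ext
      intro s
      rw [realize_diagTerm, mem_diag]
      exact ⟨fun _ => rfl, fun _ => hW s.1⟩
  rw [hset]
  refine forall_congr' fun s => ?_
  unfold serialOrderTerm
  simp only [realize_cylTerm a, realize_cylTerm b (cylTerm c _), realize_cylTerm c (addTerm _ _),
    mem_cyl]
  refine exists_congr fun u₁ => exists_congr fun u₂ => exists_congr fun u₃ => ?_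
  generalize Function.update (Function.update (Function.update s a u₁) b u₂) c u₃ = t
  unfold OrderFailsAt
  rw [realize_addTerm, mem_add, realize_addTerm, mem_add, realize_addTerm, mem_add,
    mem_realize_infTerm, mem_realize_infTerm, mem_realize_infTerm, mem_realize_infTerm,
    realize_negTerm, mem_neg, realize_negTerm, mem_neg, realize_negTerm, mem_neg, hy, hz,
    realize_cylTerm, mem_cyl, realize_cylTerm, mem_cyl, realize_diagTerm, mem_diag]
  rfl

end EquationInSetAlgebra

/-! ### The height order is a serial strict order -/

section HeightOrder

variable {α : Type u} [DecidableEq α] {a b c : α}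
  {h : ({p : α // p ≠ b ∧ p ≠ c} → α × ℕ) → ℕ}

/-- Heights ignore b, so interchanging a and b has the same effect as copying b to a. -/
theorem mem_heightLt {s : α → α × ℕ} :
    point s ∈ heightLt h a ↔ height h s < height h (Function.update s a (s b)) := by
  change height h s < height h (s ∘ Equiv.swap a b) ↔ _
  have : height h (s ∘ Equiv.swap a b) = height h (Function.update s a (s b)) := by
    apply height_congr
    intro p hpb _
    by_cases hpa : p = a
    · simp [hpa]
    · simp [hpa, Equiv.swap_apply_of_ne_of_ne hpa hpb]
  rw [this]

/-- Make a hole at a in the base point and prescribe the height N + 1. The new entry has positive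
second coordinate, so the sequence stays injective. -/
theorem IsGeneric.exists_lt_height_update (hh : IsGeneric (fun p => p ≠ b ∧ p ≠ c) h)
    (hab : a ≠ b) (hac : a ≠ c) (N : ℕ) :
    ∃ x, N < height h (Function.update (fun p => (p, 0)) a x) := by
  obtain ⟨x, hx, hx'⟩ := hh.exists_height_fill (κ := PUnit)
    (fun _ => Function.update (fun p => some (p, 0)) a none)
    (fun _ => (Set.finite_singleton a).subset fun p hp => by
      by_contra hpa
      exact hp (Function.update_of_ne hpa _ _))
    (fun _ => N + 1) (fun _ _ _ => rfl) 0
  have e : fill (Function.update (fun p => some (p, 0)) a none) x =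
      Function.update (fun p => (p, 0)) a x := by
    funext p
    unfold fill
    by_cases hpa : p = a
    · simp [hpa]
    · simp [hpa]
  have := hx' ⟨⟩ ⟨a, hab, hac, Function.update_self _ _ _⟩
  rw [e] at this
  refine ⟨x, (Nat.lt_succ_self N).trans_eq (this ?_).symm⟩
  intro p q _ _ _ _ hpq
  by_cases hpa : p = a <;> by_cases hqa : q = a
  · rw [hpa, hqa]
  · subst hpa
    rw [Function.update_self, Function.update_of_ne hqa] at hpq
    rw [hpq] at hx
    exact absurd hx (lt_irrefl 0)
  · subst hqa
    rw [Function.update_self, Function.update_of_ne hpa] at hpq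
    rw [← hpq] at hx
    exact absurd hx (lt_irrefl 0)
  · rw [Function.update_of_ne hpa, Function.update_of_ne hqa] at hpq
    exact congrArg Prod.fst hpq

/-- Irreflexivity and transitivity are those of < on ℕ, and independence of c holds because h
ignores c. Only seriality uses that s is the base point off a, b, c. -/
theorem not_orderFailsAt_heightLt (hh : IsGeneric (fun p => p ≠ b ∧ p ≠ c) h)
    (hab : a ≠ b) (hac : a ≠ c) (hbc : b ≠ c) {s : α → α × ℕ}
    (hs : ∀ p, p ≠ a → p ≠ b → p ≠ c → s p = (p, 0)) :
    ¬ OrderFailsAt a b c (heightLt h a) s := by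
  unfold OrderFailsAt
  simp only [mem_heightLt]
  have heq : ∀ t t' : α → α × ℕ, (∀ p, p ≠ b → p ≠ c → t p = t' p) → height h t = height h t' :=
    fun _ _ => height_congr
  rintro ((⟨⟨x, hx⟩, hx'⟩ | ⟨e, hlt⟩) | hx | ⟨⟨h1, h2⟩, h3⟩)
  · apply hx'
    rw [heq (Function.update s c x) s (fun p _ hpc => by simp [hpc])] at hx
    refine hx.trans_eq (heq _ _ fun p _ hpc => ?_)
    by_cases hpa : p = a
    · simp [hpa, hbc]
    · simp [hpa, hpc]
  · rw [← e, Function.update_eq_self] at hlt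
    exact lt_irrefl _ hlt
  · obtain ⟨x, hN⟩ := hh.exists_lt_height_update hab hac (height h s)
    refine hx ⟨x, ?_⟩
    rw [heq (Function.update s b x) s (fun p hpb _ => by simp [hpb])]
    refine hN.trans_eq (heq _ _ fun p hpb hpc => ?_)
    by_cases hpa : p = a
    · simp [hpa]
    · simp [hpa, hpb, hs p hpa hpb hpc]
  · apply h3
    have e2 := heq (Function.update (Function.update s a (s b)) b (s c))
      (Function.update s a (s b)) fun p hpb _ => by simp [hpb]
    rw [e2] at h2
    rw [heq (Function.update s b (s c)) s (fun p hpb _ => by simp [hpb])]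
    refine (h1.trans h2).trans_eq (heq _ _ fun p hpb _ => ?_)
    by_cases hpa : p = a
    · simp [hpa]
    · simp [hpa, hpb]

end HeightOrder

/-! ### Invariant sets do not contain serial strict orders independent of a further index -/

section Pair

variable {α : Type u} [DecidableEq α] {β : Type v} {γ : Type w}

/-- The sequence with entry `y` at `b`, entry `x` at the indices in `G` and the entries of `s`
elsewhere. -/
def pair (G : Finset α) (b : α) (s : α → β) (x y : β) : α → β :=
  fun p => if p = b then y else if p ∈ G then x else s p

theorem pair_mem {G : Finset α} {b : α} {s : α → β} {x y : β} {q : α}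
    (hq : q ∉ insert b G) : pair G b s x y q = s q := by
  simp only [Finset.mem_insert, not_or] at hq
  simp [pair, hq]

theorem pair_ker {G E : Finset α} {b : α} {s : α → β} {s' : α → γ} {x y : β} {x' y' : γ}
    (hxy : x ≠ y) (hxy' : x' ≠ y') (hE : ∀ p ∈ E, s p ≠ x ∧ s p ≠ y)
    (hE' : ∀ p ∈ E, s' p ≠ x' ∧ s' p ≠ y') (hss : ∀ p ∈ E, ∀ q ∈ E, s p = s q ↔ s' p = s' q)
    {F : Finset α} (hF : ∀ p ∈ F, p ≠ b → p ∉ G → p ∈ E) :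
    ∀ p ∈ F, ∀ q ∈ F, pair G b s x y p = pair G b s x y q ↔
      pair G b s' x' y' p = pair G b s' x' y' q := by
  intro p hp q hq
  have hp' := hF p hp
  have hq' := hF q hq
  unfold pair
  split_ifs with h1 h2 h3 h4 h5 h6 h7 h8
  all_goals grind

end Pair

/-! ### Too few values for a nonzero height -/

section Counting

variable {α : Type u} [DecidableEq α] {b c : α} {F : Finset α}

/-- A transformation of `F` followed by a sequence with too few values on `F` cannot be injective
off `b` and `c`. -/
theorem not_injOff_comp {β : Type v} [DecidableEq β] (hb : b ∈ F) (hc : c ∈ F) (hbc : b ≠ c)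
    {f : α → β} {Q : Finset β} (hQ : Q.card + 2 < F.card)
    (hf : ∀ p ∈ F, p ≠ b → p ≠ c → f p ∈ Q) : ¬ InjOff b c f := by
  intro hi
  have hcard : ((F.erase b).erase c).card + 2 = F.card := by
    have h1 := Finset.card_erase_add_one hb
    have h2 := Finset.card_erase_add_one (Finset.mem_erase.2 ⟨hbc.symm, hc⟩)
    omega
  have hmem : ∀ p ∈ (F.erase b).erase c, p ∈ F ∧ p ≠ b ∧ p ≠ c := by
    intro p hp
    simp only [Finset.mem_erase] at hp
    exact ⟨hp.2.2, hp.2.1, hp.1⟩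
  have hle := Finset.card_le_card_of_injOn f
    (fun p hp => hf p (hmem p hp).1 (hmem p hp).2.1 (hmem p hp).2.2)
    (fun p hp q hq e => hi p q (hmem p hp).2.1 (hmem p hp).2.2 (hmem q hq).2.1 (hmem q hq).2.2 e)
  omega

end Counting

/-! ### Equivalent pairs of entries -/

section Swap

variable {α : Type u} [DecidableEq α] {a b c i : α}
  {h : ({p : α // p ≠ b ∧ p ≠ c} → α × ℕ) → ℕ} {F E : Finset α} {s : α → α × ℕ}

theorem simCore_pair (hFE : F = E ∪ {a, b, c, i}) {x y x' y' : α × ℕ} (hxy : x ≠ y)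
    (hxy' : x' ≠ y') (hE : ∀ p ∈ E, s p ≠ x ∧ s p ≠ y) (hE' : ∀ p ∈ E, s p ≠ x' ∧ s p ≠ y')
    (hx : Near s → ((∃ q ∉ F, x = s q) ↔ ∃ q ∉ F, x' = s q))
    (hy : Near s → ((∃ q ∉ F, y = s q) ↔ ∃ q ∉ F, y' = s q)) :
    SimCore F (pair {a, c, i} b s x y) (pair {a, c, i} b s x' y') := by
  have hoff : ∀ q ∉ F, ∀ z w : α × ℕ, pair {a, c, i} b s z w q = s q := by
    intro q hq z w
    subst hFE
    refine pair_mem fun hq' => hq ?_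
    simp only [Finset.mem_insert, Finset.mem_singleton, Finset.mem_union] at hq' ⊢
    tauto
  refine ⟨fun p hp => by rw [hoff p hp, hoff p hp], ?_, fun hn p hp => ?_⟩
  · refine pair_ker hxy hxy' hE hE' (fun _ _ _ _ => Iff.rfl) fun p hp h1 h2 => ?_
    subst hFE
    simp only [Finset.mem_insert, Finset.mem_singleton, Finset.mem_union] at h2 hp
    tauto
  · have hn' : Near s := hn.congr fun p hp => hoff p hp x y
    have key : ∀ z w u : α × ℕ, (∃ q ∉ F, u = pair {a, c, i} b s z w q) ↔ ∃ q ∉ F, u = s q :=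
      fun z w u => exists_congr fun q => and_congr_right fun hq => by rw [hoff q hq]
    rw [key, key]
    by_cases h1 : p = b
    · simpa [pair, h1] using hy hn'
    · by_cases h2 : p ∈ ({a, c, i} : Finset α)
      · simpa only [pair, if_neg h1, if_pos h2] using hx hn'
      · simp only [pair, if_neg h1, if_neg h2]

/-- Two elements none of which is seen by the heights can be interchanged. -/
theorem sim_pair_swap (hh : IsGeneric (fun p => p ≠ b ∧ p ≠ c) h) (hbc : b ≠ c)
    (hFE : F = E ∪ {a, b, c, i}) (hcard : F.card = E.card + 4) {x y : α × ℕ} (hxy : x ≠ y)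
    (hE : ∀ p ∈ E, s p ≠ x ∧ s p ≠ y)
    (hT : Near s → (∃ q ∉ F, x = s q) ∧ ∃ q ∉ F, y = s q) :
    Sim h F (pair {a, c, i} b s x y) (pair {a, c, i} b s y x) := by
  have hb : b ∈ F := by simp [hFE]
  have hc : c ∈ F := by simp [hFE]
  have core : SimCore F (pair {a, c, i} b s x y) (pair {a, c, i} b s y x) :=
    simCore_pair hFE hxy hxy.symm hE (fun p hp => (hE p hp).symm)
      (fun hn => ⟨fun _ => (hT hn).2, fun _ => (hT hn).1⟩)
      (fun hn => ⟨fun _ => (hT hn).1, fun _ => (hT hn).2⟩)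
  have hoff : ∀ q ∉ F, pair {a, c, i} b s x y q = s q := by
    intro q hq
    subst hFE
    refine pair_mem fun hq' => hq ?_
    simp only [Finset.mem_insert, Finset.mem_singleton, Finset.mem_union] at hq' ⊢
    tauto
  refine ⟨core, fun τ hτ => core.height_comp_eq hh hb hc hτ fun hn hi _ => ?_⟩
  have hn' : Near s := hn.congr hoff
  -- Both x and y also occur outside F, so an injective substitute cannot use them on the indices of
  -- F that h sees. Only the values on E remain, too few for |E| + 2 indices.
  refine absurd hi (not_injOff_comp hb hc hbc (Q := E.image s)
    (by have := Finset.card_image_le (s := E) (f := s); omega) fun p hp hpb hpc => ?_)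
  have hnT : ∀ q ∉ F, pair {a, c, i} b s x y (τ p) ≠ s q := by
    intro q hq e
    have hpq := hi p q hpb hpc (fun e => hq (e ▸ hb)) (fun e => hq (e ▸ hc))
      (by simp only [Function.comp_apply, hτ.1 q hq, hoff q hq, e])
    exact hq (hpq ▸ hp)
  simp only [Function.comp_apply]
  have hτp := hτ.2 p hp
  by_cases h1 : τ p = b
  · obtain ⟨q, hq, e⟩ := (hT hn').2
    exact absurd (by simp [pair, h1, e]) (hnT q hq)
  · by_cases h2 : τ p ∈ ({a, c, i} : Finset α)
    · obtain ⟨q, hq, e⟩ := (hT hn').1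
      refine absurd ?_ (hnT q hq)
      rw [← e]
      simp only [pair, if_neg h1, if_pos h2]
    · simp only [pair, if_neg h1, if_neg h2]
      refine Finset.mem_image_of_mem _ ?_
      rw [hFE] at hτp
      simp only [Finset.mem_insert, Finset.mem_singleton, Finset.mem_union] at h2 hτp
      tauto

/-- Two new elements `x`, `y` can be completed to a triangle with equivalent edges. -/
theorem exists_sim_pair_triangle (hh : IsGeneric (fun p => p ≠ b ∧ p ≠ c) h) (hbc : b ≠ c)
    (hFE : F = E ∪ {a, b, c, i}) (hcard : F.card = E.card + 4) (hn : Near s) {x y : α × ℕ}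
    (hxy : x ≠ y) (hE : ∀ p ∈ E, s p ≠ x ∧ s p ≠ y)
    (hx : ¬ ∃ q ∉ F, x = s q) (hy : ¬ ∃ q ∉ F, y = s q) :
    ∃ z, Sim h F (pair {a, c, i} b s x y) (pair {a, c, i} b s y z) ∧
      Sim h F (pair {a, c, i} b s x y) (pair {a, c, i} b s z x) := by
  have hb : b ∈ F := by simp [hFE]
  have hc : c ∈ F := by simp [hFE]
  have hmemE : ∀ p ∈ F, p ≠ b → p ∉ ({a, c, i} : Finset α) → p ∈ E := by
    intro p hp h1 h2
    rw [hFE] at hp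
    simp only [Finset.mem_insert, Finset.mem_singleton, Finset.mem_union] at h2 hp
    tauto
  have few : ∀ (u : α × ℕ) (f : α → α × ℕ), (∀ p ∈ F, p ≠ b → p ≠ c → f p ∈ insert u (E.image s)) →
      ¬ InjOff b c f := fun u f hf => not_injOff_comp hb hc hbc
    (by have := Finset.card_image_le (s := E) (f := s)
        have := Finset.card_insert_le u (E.image s)
        omega) hf
  obtain ⟨B, hB⟩ := hn.exists_bound
  -- The hole stands for z: `true` describes the pair (y, z) and `false` the pair (z, x).
  let o : Bool → α → Option (α × ℕ) := fun β =>
    if β then pair {a, c, i} b (fun p => some (s p)) (some y) none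
    else pair {a, c, i} b (fun p => some (s p)) none (some x)
  have ho : ∀ β, {p | o β p ≠ some (p, 0)}.Finite := by
    intro β
    refine (hn.union F.finite_toSet).subset fun p hp => ?_
    by_cases hpF : p ∈ F
    · exact .inr hpF
    · refine .inl fun e => hp ?_
      have hp' : p ∉ insert b ({a, c, i} : Finset α) := by
        intro hp'
        apply hpF
        rw [hFE]
        simp only [Finset.mem_insert, Finset.mem_singleton, Finset.mem_union] at hp' ⊢
        tauto
      cases β <;> simp only [o, if_true, Bool.false_eq_true, if_false] <;> rw [pair_mem hp', e]
  have hker : ∀ β, ∀ p ∈ F, ∀ q ∈ F, o β p = o β q →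
      pair {a, c, i} b s x y p = pair {a, c, i} b s x y q := by
    intro β p hp q hq
    cases β
    · exact (pair_ker (s := fun p => some (s p)) (x := none) (y := some x) (by simp) hxy (E := E)
        (fun p hp => by simpa using (hE p hp).1) hE
        (fun p _ q _ => by simp) hmemE p hp q hq).1
    · exact (pair_ker (s := fun p => some (s p)) (x := some y) (y := none) (by simp) hxy (E := E)
        (fun p hp => by simpa using (hE p hp).2) hE
        (fun p _ q _ => by simp) hmemE p hp q hq).1
  -- Where the two patterns agree, neither x nor y can occur, which leaves the hole and the values
  -- on E. These are at most |E| + 1 values, so both prescribed heights are 0 and the prescriptions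
  -- are consistent.
  have hcross : ∀ τ τ', IsEndoOn F τ → IsEndoOn F τ' →
      (∀ p, p ≠ b → p ≠ c → o true (τ p) = o false (τ' p)) →
      height h (pair {a, c, i} b s x y ∘ τ) = 0 ∧ height h (pair {a, c, i} b s x y ∘ τ') = 0 := by
    intro τ τ' hτ hτ' e
    constructor
    · refine hh.height_eq_zero (few y _ fun p hp hpb hpc => ?_)
      have e' := e p hpb hpc
      have h1 := hmemE _ (hτ.2 p hp)
      have h1' := hmemE _ (hτ'.2 p hp)
      simp only [o, if_true, Bool.false_eq_true, if_false, pair] at e'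
      simp only [pair, Function.comp_apply, Finset.mem_insert, Finset.mem_image]
      grind
    · refine hh.height_eq_zero (few x _ fun p hp hpb hpc => ?_)
      have e' := e p hpb hpc
      have h1 := hmemE _ (hτ.2 p hp)
      have h1' := hmemE _ (hτ'.2 p hp)
      simp only [o, if_true, Bool.false_eq_true, if_false, pair] at e'
      simp only [pair, Function.comp_apply, Finset.mem_insert, Finset.mem_image]
      grind
  obtain ⟨z, hz, hz'⟩ := hh.exists_height_fill_comp (F := F) o
    (fun _ => pair {a, c, i} b s x y) ho (fun β β' τ τ' hτ hτ' e => by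
      by_cases hββ : β = β'
      · subst hββ
        apply height_congr
        intro p hpb hpc
        simp only [Function.comp_apply]
        by_cases hp : p ∈ F
        · exact hker β _ (hτ.2 p hp) _ (hτ'.2 p hp) (e p hpb hpc)
        · rw [hτ.1 p hp, hτ'.1 p hp]
      · cases β <;> cases β'
        · exact absurd rfl hββ
        · obtain ⟨e1, e2⟩ := hcross τ' τ hτ' hτ fun p hpb hpc => (e p hpb hpc).symm
          rw [e1, e2]
        · obtain ⟨e1, e2⟩ := hcross τ τ' hτ hτ' e
          rw [e1, e2]
        · exact absurd rfl hββ) (max B (max x.2 y.2))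
  have hzB : B < z.2 ∧ x.2 < z.2 ∧ y.2 < z.2 := by
    simpa only [max_lt_iff] using hz
  have hzs : ∀ q, s q ≠ z := fun q e => by
    have := hB q
    rw [e] at this
    omega
  have hzx : x ≠ z := fun e => by
    rw [← e] at hzB
    omega
  have hzy : y ≠ z := fun e => by
    rw [← e] at hzB
    omega
  have hzT : ¬ ∃ q ∉ F, z = s q := fun ⟨q, _, e⟩ => hzs q e.symm
  have filltrue : fill (o true) z = pair {a, c, i} b s y z := by
    funext p
    simp only [fill, o, if_true, pair]
    split_ifs <;> rfl
  have fillfalse : fill (o false) z = pair {a, c, i} b s z x := by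
    funext p
    simp only [fill, o, Bool.false_eq_true, if_false, pair]
    split_ifs <;> rfl
  refine ⟨z, ?_, ?_⟩
  · have core : SimCore F (pair {a, c, i} b s x y) (pair {a, c, i} b s y z) :=
      simCore_pair hFE hxy hzy hE (fun p hp => ⟨(hE p hp).2, hzs p⟩)
        (fun _ => by simp only [hx, hy]) (fun _ => by simp only [hy, hzT])
    refine ⟨core, fun τ hτ => core.height_comp_eq hh hb hc hτ fun _ hi hi' => ?_⟩
    have key := hz' true τ hτ
    rw [filltrue] at key
    refine (key ?_ hi').symm
    -- A substitute that misses the hole omits y, so the values on E together with x are too few for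
    -- injectivity.
    by_contra hne
    refine few x _ (fun p hp hpb hpc => ?_) hi
    have hb' : τ p ≠ b := fun e => hne ⟨p, hpb, hpc, by simp [o, pair, e]⟩
    have h1 := hmemE _ (hτ.2 p hp) hb'
    simp only [pair, Function.comp_apply, if_neg hb', Finset.mem_insert, Finset.mem_image]
    grind
  · have core : SimCore F (pair {a, c, i} b s x y) (pair {a, c, i} b s z x) :=
      simCore_pair hFE hxy hzx.symm hE (fun p hp => ⟨hzs p, (hE p hp).1⟩)
        (fun _ => by simp only [hx, hzT]) (fun _ => by simp only [hx, hy])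
    refine ⟨core, fun τ hτ => core.height_comp_eq hh hb hc hτ fun _ hi hi' => ?_⟩
    have key := hz' false τ hτ
    rw [fillfalse] at key
    refine (key ?_ hi').symm
    -- Likewise with x omitted.
    by_contra hne
    refine few y _ (fun p hp hpb hpc => ?_) hi
    have hG : τ p = b ∨ τ p ∉ ({a, c, i} : Finset α) := by
      by_contra hG
      push Not at hG
      refine hne ⟨p, hpb, hpc, ?_⟩
      simp only [o, Bool.false_eq_true, if_false, pair, if_neg hG.1, if_pos hG.2]
    have h1 := hmemE _ (hτ.2 p hp)
    simp only [pair, Function.comp_apply, Finset.mem_insert, Finset.mem_image]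
    grind

end Swap

/-- In a serial strict order some two elements outside a finite set, that agree with respect to a
given predicate, are comparable. -/
theorem exists_rel_of_serial {β : Type v} [Nonempty β] {R : β → β → Prop} (hirr : ∀ x, ¬ R x x)
    (htrans : ∀ x y z, R x y → R y z → R x z) (hser : ∀ x, ∃ y, R x y) {P : Set β}
    (hP : P.Finite) (T : β → Prop) : ∃ x y, x ∉ P ∧ y ∉ P ∧ (T x ↔ T y) ∧ R x y := by
  choose g hg using hser
  let f : ℕ → β := fun n => g^[n] (Classical.arbitrary β)
  have hsucc : ∀ n, R (f n) (f (n + 1)) := by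
    intro n
    simp only [f, Function.iterate_succ_apply']
    exact hg _
  have hlt : ∀ m n, m < n → R (f m) (f n) := by
    intro m n hmn
    induction n, hmn using Nat.le_induction with
    | base => exact hsucc m
    | succ n _ ih => exact htrans _ _ _ ih (hsucc n)
  have hinj : Function.Injective f := by
    intro m n e
    rcases lt_trichotomy m n with h | h | h
    · exact absurd (e ▸ hlt m n h) (hirr _)
    · exact h
    · exact absurd (e ▸ hlt n m h) (hirr _)
  have hinf : {n | f n ∉ P}.Infinite := (hP.preimage hinj.injOn).infinite_compl
  -- Pigeonhole on the two truth values of T along an infinite chain.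
  obtain ⟨m, hm, n, hn, hmn, e⟩ := hinf.exists_ne_map_eq_of_mapsTo
    (f := fun n => T (f n)) (t := Set.univ) (fun _ _ => trivial) Set.finite_univ
  rcases lt_or_gt_of_ne hmn with h | h
  · exact ⟨f m, f n, hm, hn, e.to_iff, hlt m n h⟩
  · exact ⟨f n, f m, hn, hm, e.symm.to_iff, hlt n m h⟩

/-- Otherwise R is a serial strict order. As Z ignores i, and membership ignores c on the section, R
x y is decided by `pair {a, c, i} b s x y`, and the count of values forces a cycle. -/
theorem exists_orderFailsAt {α : Type u} [DecidableEq α] [Infinite α] {a b c i : α} (hab : a ≠ b)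
    (hac : a ≠ c) (hbc : b ≠ c) (hia : i ≠ a) (hib : i ≠ b) (hic : i ≠ c)
    {h : ({p : α // p ≠ b ∧ p ≠ c} → α × ℕ) → ℕ} (hh : IsGeneric (fun p => p ≠ b ∧ p ≠ c) h)
    {Z : FullSetAlgebra (Set.univ : Set (α → α × ℕ))} (hZ : IsInvariant h Z)
    (hi : ∀ s x, point (Function.update s i x) ∈ Z → point s ∈ Z) (s : α → α × ℕ) :
    ∃ u₁ u₂ u₃, OrderFailsAt a b c Z
      (Function.update (Function.update (Function.update s a u₁) b u₂) c u₃) := by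
  by_contra hcon
  push Not at hcon
  let tri (x y z : α × ℕ) : α → α × ℕ :=
    Function.update (Function.update (Function.update s a x) b y) c z
  have hcon' : ∀ x y z, ¬ OrderFailsAt a b c Z (tri x y z) := hcon
  simp only [OrderFailsAt, not_or, not_and, not_not] at hcon'
  have ha (x y z) : tri x y z a = x := by simp [tri, hab, hac]
  have hb (x y z) : tri x y z b = y := by simp [tri, hbc]
  have hc (x y z) : tri x y z c = z := by simp [tri]
  have ua (x y z w) : Function.update (tri x y z) a w = tri w y z := by
    simp only [tri]
    rw [Function.update_comm hac.symm, Function.update_comm hab.symm, Function.update_idem]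
  have ub (x y z w) : Function.update (tri x y z) b w = tri x w z := by
    simp only [tri]
    rw [Function.update_comm hbc.symm, Function.update_idem]
  have uc (x y z w) : Function.update (tri x y z) c w = tri x y w := by
    simp only [tri, Function.update_idem]
  have hind (x y z w) (hm : point (tri x y w) ∈ Z) : point (tri x y z) ∈ Z :=
    (hcon' x y z).1.1 ⟨w, by rwa [uc]⟩
  let R (x y : α × ℕ) : Prop := point (tri x y x) ∈ Z
  have hirr (x) : ¬ R x x := (hcon' x x x).1.2 (by rw [ha, hb])
  have hser (x) : ∃ y, R x y := by
    obtain ⟨y, hy⟩ := (hcon' x x x).2.1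
    rw [ub] at hy
    exact ⟨y, hy⟩
  have htrans (x y z) (hxy : R x y) (hyz : R y z) : R x z := by
    have := (hcon' x y z).2.2
    rw [ua, hb, hc, ub, ub] at this
    exact hind _ _ _ _ (this ⟨hind _ _ _ _ hxy, hind _ _ _ _ hyz⟩)
  have hpair (x y) : point (pair {a, c, i} b s x y) ∈ Z ↔ R x y := by
    have e : pair {a, c, i} b s x y = Function.update (tri x y x) i x := by
      funext p
      simp only [pair, tri, Function.update_apply, Finset.mem_insert, Finset.mem_singleton]
      grind
    rw [e]
    refine ⟨hi _ _, fun hm => hi _ (tri x y x i) ?_⟩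
    rwa [Function.update_idem, Function.update_eq_self]
  obtain ⟨F₀, hF₀⟩ := hZ
  let E : Finset α := F₀ \ {a, b, c, i}
  let F : Finset α := E ∪ {a, b, c, i}
  have hF : F₀ ⊆ F := fun p hp => by
    by_cases hp' : p ∈ ({a, b, c, i} : Finset α)
    · exact Finset.mem_union_right _ hp'
    · exact Finset.mem_union_left _ (Finset.mem_sdiff.2 ⟨hp, hp'⟩)
  have hcard : F.card = E.card + 4 := by
    rw [Finset.card_union_of_disjoint Finset.sdiff_disjoint]
    congr 1
    rw [Finset.card_insert_of_notMem (by simp [hab, hac, hia.symm]),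
      Finset.card_insert_of_notMem (by simp [hbc, hib.symm]),
      Finset.card_insert_of_notMem (by simp [hic.symm]), Finset.card_singleton]
  have hsim (x y x' y') (hs : Sim h F (pair {a, c, i} b s x y) (pair {a, c, i} b s x' y'))
      (hR : R x y) : R x' y' :=
    (hpair _ _).1 (hF₀ F hF (by simp [F]) (by simp [F]) _ _ hs ((hpair _ _).2 hR))
  have : Nonempty (α × ℕ) := ⟨s a⟩
  -- The predicate records occurrence outside F, the information kept by the `mem` clause of
  -- `SimCore`; x and y must agree on it to be interchangeable.
  obtain ⟨x, y, hx, hy, hT, hR⟩ := exists_rel_of_serial hirr htrans hser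
    (E.image s).finite_toSet fun x => ∃ q ∉ F, x = s q
  have hxy : x ≠ y := fun e => hirr x (by rwa [← e] at hR)
  have hE : ∀ p ∈ E, s p ≠ x ∧ s p ≠ y := fun p hp =>
    ⟨fun e => hx (Finset.mem_coe.2 (Finset.mem_image.2 ⟨p, hp, e⟩)),
      fun e => hy (Finset.mem_coe.2 (Finset.mem_image.2 ⟨p, hp, e⟩))⟩
  -- If s is not near the base point, or x and y both occur outside F, the pair can be reversed;
  -- otherwise a triangle x, y, z closes a cycle.
  by_cases hcase : Near s → ∃ q ∉ F, x = s q
  · exact hirr x (htrans _ _ _ hR (hsim _ _ _ _ (sim_pair_swap hh hbc rfl hcard hxy hE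
      fun hn => ⟨hcase hn, hT.1 (hcase hn)⟩) hR))
  · rw [Classical.not_imp] at hcase
    obtain ⟨z, h1, h2⟩ := exists_sim_pair_triangle hh hbc rfl hcard hcase.1 hxy hE hcase.2
      fun hy' => hcase.2 (hT.2 hy')
    exact hirr x (htrans _ _ _ hR (htrans _ _ _ (hsim _ _ _ _ h1 hR) (hsim _ _ _ _ h2 hR)))

end CylAlg

/-! ### The axiom and its failure in the invariant algebra -/

theorem corollary4p9 (α : Type u) [Infinite α] :
    ∃ φ : (CylAlg.lang α).Sentence,
      CylAlg.IsInductivityAxiom φ ∧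
      CylAlg.IsDeltaTwo φ ∧
      (∀ (A : Type v) [(CylAlg.lang α).Structure A],
        CylAlg.IsLocallyFiniteDimensional α A → A ⊨ φ) ∧
      ∃ (A : Type u) (_ : (CylAlg.lang α).Structure A),
        CylAlg.IsRepresentable α A ∧ ¬ A ⊨ φ := by
  classical
  let e := Infinite.natEmbedding α
  have hne {m n : ℕ} (hmn : m ≠ n) : e m ≠ e n := e.injective.ne hmn
  have hab : e 0 ≠ e 1 := hne (by simp)
  have hac : e 0 ≠ e 2 := hne (by simp)
  have hbc : e 1 ≠ e 2 := hne (by simp)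
  have hia : e 3 ≠ e 0 := hne (by simp)
  have hib : e 3 ≠ e 1 := hne (by simp)
  have hic : e 3 ≠ e 2 := hne (by simp)
  generalize e 0 = a at hab hac hia
  generalize e 1 = b at hab hbc hib
  generalize e 2 = c at hac hbc hic
  generalize e 3 = i at hia hib hic
  let x : (CylAlg.lang α).Term (Empty ⊕ Fin 1) := Term.var (Sum.inr 0)
  let τ := CylAlg.serialOrderTerm a b c x
  let σ := CylAlg.diagTerm (Empty ⊕ Fin 1) a a
  have hind : i ∉ CylAlg.ind τ ∪ CylAlg.ind σ := by
    rintro (hi | hi)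
    · have := CylAlg.ind_serialOrderTerm_subset a b c _ hi
      simp [hia, hib, hic] at this
    · rw [CylAlg.ind_diagTerm] at hi
      simp [hia] at hi
  have hφ : CylAlg.IsInductivityAxiom
      (((CylAlg.substCyl i τ).bdEqual (CylAlg.substCyl i σ)).alls.imp (τ.bdEqual σ).alls) :=
    ⟨1, τ, σ, i, hind, rfl⟩
  refine ⟨_, hφ, CylAlg.isDeltaTwo_alls_imp_alls _ _ _ _,
    fun A _ hA => hA.realize_of_isInductivityAxiom hφ, ?_⟩
  obtain ⟨h, hh⟩ := CylAlg.exists_isGeneric α fun p => p ≠ b ∧ p ≠ c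
  refine ⟨CylAlg.invariantAlgebra hh, inferInstance,
    ⟨α × ℕ, Set.univ, CylAlg.isDisjointUnionOfSpaces_univ, ⟨Substructure.subtype _⟩⟩, ?_⟩
  intro hreal
  change Formula.Realize _ _ at hreal
  unfold Formula.Realize at hreal
  rw [BoundedFormula.realize_imp, CylAlg.realize_boundedFormula_alls,
    CylAlg.realize_boundedFormula_alls] at hreal
  have hemb (ρ : (CylAlg.lang α).Term (Empty ⊕ Fin 1))
      (v : Empty ⊕ Fin 1 → CylAlg.invariantAlgebra hh) :
      (ρ.realize v).1 = ρ.realize fun k => (v k).1 :=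
    (HomClass.realize_term (Substructure.subtype (CylAlg.invariantAlgebra hh))
      (t := ρ) (v := v)).symm
  have hcyl (Z : CylAlg.invariantAlgebra hh) :
      (CylAlg.cyl i Z).1 = CylAlg.cyl i Z.1 :=
    CylAlg.funMap_cyl i _
  -- The conclusion fails at the height order; the remaining goal is the premise, about the
  -- invariant sets c_i x, which ignore i.
  have key := hreal (fun xs => ?_) fun _ => ⟨CylAlg.heightLt h a, CylAlg.isInvariant_heightLt a⟩
  · rw [BoundedFormula.realize_bdEqual, ← Subtype.coe_inj, hemb, hemb,
      CylAlg.realize_serialOrderTerm_eq_iff hab hac hbc] at key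
    obtain ⟨u₁, u₂, u₃, hfail⟩ := key fun p => (p, 0)
    refine CylAlg.not_orderFailsAt_heightLt hh hab hac hbc (fun p hpa hpb hpc => ?_) hfail
    simp [hpa, hpb, hpc]
  · rw [BoundedFormula.realize_bdEqual, CylAlg.realize_substCyl, CylAlg.realize_substCyl,
      ← Subtype.coe_inj, hemb, hemb, CylAlg.realize_serialOrderTerm_eq_iff hab hac hbc]
    intro s
    refine CylAlg.exists_orderFailsAt hab hac hbc hia hib hic hh ?_ ?_ s
    · exact Subtype.prop (CylAlg.cyl i (xs 0))
    · intro t z ht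
      change CylAlg.point _ ∈ (CylAlg.cyl i (xs 0)).1 at ht
      change CylAlg.point _ ∈ (CylAlg.cyl i (xs 0)).1
      rw [hcyl, CylAlg.mem_cyl] at ht ⊢
      obtain ⟨y, hy⟩ := ht
      exact ⟨y, by rwa [Function.update_idem] at hy⟩
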